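/- Let $k\ge 1$, $l\ge 0$, $\mu_1\ge\dots\ge\mu_k>0$ and $m_1,\dots,m_l\ge 0$, and let $M=\mathbb R^{2+k+l}$, with coordinates $(x^+,x^-,x^i,y^a)$, carry the plane wave metric $$ds^2=-2\,dx^+dx^--\Big(\sum_i\mu_i^2x_i^2-\sum_a m_a^2y_a^2\Big)(dx^+)^2+\sum_i dx_i^2+\sum_a dy_a^2,$$ time-oriented so that $x^+$ increases along future-directed timelike curves. Let $I^\pm(p)$ be the chronological future/past of $p$ (points joined to $p$ by timelike curves). For a sequence $s=(x_n)$ in $M$, the sets $I^-(x_n)$ *converge* to an open past set $P$, written $I^-(\lim s)=P$, if every $p\in P$ lies in $I^-(x_n)$ for all large $n$ and every $p\notin \mathrm{Cl}\,P$ lies outside $\mathrm{Cl}\,I^-(x_n)$ for all large $n$; similarly for $I^+$ and open future sets. Write $w^j$ for the transverse coordinates $x^i,y^a$. Quotients are taken in $[-\infty,\infty]$, with $a/0=\pm\infty$ (sign of $a$) for $a\ne0$ and $0/0=0$. Consider sequences $s$ with no limit point in $M$ all of whose coordinate sequences converge in $[-\infty,\infty]$. Such an $s$ lies in $\mathcal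 C_1$ if all $(w^j_n)^2/x^-_n$ converge to finite real numbers $c_j$; in $\mathcal C_1^{+}$ (resp. $\mathcal C_1^-$) if moreover $x^-_n>0$ (resp. $x_n^-<0$) for all $n$; and in $\mathcal C_{\rm except}$ if all ratios of two different transverse coordinates converge in $[-\infty,\infty]$ and at least one of the sequences $(w^j_n)^2/x_n^-$ diverges to $+\infty$ or to $-\infty$. For real weights $w=(w_i,w_a)$ put $F_w(\delta)=\sum_i\mu_iw_i\cot(\mu_i\delta)+\sum_a m_aw_a\coth(m_a\delta)$, where $m_a\coth(m_a\delta)$ means $1/\delta$ if $m_a=0$. Let $\delta(r,w)$ be the smaller of $\pi/\mu_1$ and the smallest positive solution of $r=F_w(\delta)$ (just $\pi/\mu_1$ if there is no solution), except that $\delta(r,0)=0$ for $r>0$. 1. Every sequence in $M$ with no limit point in $M$ has a subsequence in $\mathcal C_1^+$, in $\mathcal C_1^-$, or in $\mathcal C_{\rm except}$, or else a subsequence with $x^-_n=0$ and $w^j_n=0$ for all $n$, $j$ and $x^+_n\to+\infty$ or $x^+_n\to-\infty$. 2. For each $s$ in $\mathcal C_1^+$, $\mathcal C_1^-$ or $\mathcal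 C_{\rm except}$, with $\tilde x^+=\lim x_n^+\in[-\infty,\infty]$, the past and the future sets converge, and $$I^-(\lim s)=\{x^+<\tilde x^+-\delta^-\},\qquad I^+(\lim s)=\{x^+>\tilde x^++\delta^+\},$$ where - for $s\in\mathcal C_1^+$: $\delta^-=\delta(2,c)$ and $\delta^+=\delta(-2,c)$; - for $s\in\mathcal C_1^-$: $\delta^-=\delta(-2,|c|)$ and $\delta^+=\delta(2,|c|)$, with $|c|=(|c_j|)$; - for $s\in\mathcal C_{\rm except}$: $\delta^-=\delta^+=\delta(0,\rho)$ with $\rho_j=\lim_n (w^j_n/z_n)^2$, where $z$ is a most rapidly growing transverse coordinate, i.e. one for which all the limits $\lim_n w^j_n/z_n$ exist and are finite; such a $z$ exists, and $\delta(0,\rho)$ does not depend on its choice. 3. For every sequence with $x_n^+\to\tilde x^+\in\{+\infty,-\infty\}$, in particular for the last kind in 1., the past and the future sets converge, with $I^-(\lim s)=\{x^+<\tilde x^+\}$ and $I^+(\lim s)=\{x^+>\tilde x^+\}$ (that is, $M$ and $\emptyset$ or vice versa). -/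

import Mathlib

open Filter Topology

namespace PlaneWave

/-- Points (and, since the coordinates are global, also tangent vectors) of a plane wave with
global coordinates `(x⁺, x⁻, x¹, …, xᵏ, y¹, …, yˡ)`, with the topology of `ℝ^(2+k+l)`. -/
abbrev Point (k l : ℕ) : Type := ℝ × ℝ × (Fin k → ℝ) × (Fin l → ℝ)

section Coordinates

variable {k l : ℕ}

/-- The null coordinate `x⁺`. -/
def xp (p : Point k l) : ℝ := p.1

/-- The null coordinate `x⁻`. -/
def xm (p : Point k l) : ℝ := p.2.1

/-- The oscillator coordinates `xⁱ`. -/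
def xi (p : Point k l) : Fin k → ℝ := p.2.2.1

/-- The remaining transverse coordinates `yᵃ`. -/
def ya (p : Point k l) : Fin l → ℝ := p.2.2.2

/-- All transverse coordinates, `xⁱ` and `yᵃ`, as one family. -/
def tr (p : Point k l) : Fin k ⊕ Fin l → ℝ := Sum.elim (xi p) (ya p)

end Coordinates

section Causality

variable {k l : ℕ} (μ : Fin k → ℝ) (m : Fin l → ℝ)

/-- The plane wave metric
`ds² = -2 dx⁺ dx⁻ - (∑ μᵢ² xᵢ² - ∑ mₐ² yₐ²) (dx⁺)² + ∑ dxᵢ² + ∑ dyₐ²`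
at the point `p`, as a symmetric bilinear form evaluated on `v`, `w`. -/
def metric (p v w : Point k l) : ℝ :=
  -(xp v * xm w + xm v * xp w)
    - (∑ i, μ i ^ 2 * xi p i ^ 2 - ∑ a, m a ^ 2 * ya p a ^ 2) * (xp v * xp w)
    + ∑ i, xi v i * xi w i + ∑ a, ya v a * ya w a

/-- `p ≪ q`: there is a future-directed timelike `C¹` curve from `p` to `q`. The time orientation
is the one for which the null vector `∂/∂x⁻` is future-directed, so a timelike vector `v` is
future-directed iff `metric v ∂/∂x⁻ < 0`, that is iff its `x⁺`-component is positive. -/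
def Chron (p q : Point k l) : Prop :=
  ∃ γ : ℝ → Point k l, ContDiff ℝ 1 γ ∧ γ 0 = p ∧ γ 1 = q ∧
    ∀ t ∈ Set.Icc (0 : ℝ) 1,
      metric μ m (γ t) (deriv γ t) (deriv γ t) < 0 ∧ 0 < xp (deriv γ t)

/-- The chronological past `I⁻(p)`. -/
def IMinus (p : Point k l) : Set (Point k l) := {q | Chron μ m q p}

/-- The chronological future `I⁺(p)`. -/
def IPlus (p : Point k l) : Set (Point k l) := {q | Chron μ m p q}

/-- `P` is a past set: it equals its own chronological past. -/
def IsPastSet (P : Set (Point k l)) : Prop := (⋃ p ∈ P, IMinus μ m p) = P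

/-- `F` is a future set: it equals its own chronological future. -/
def IsFutureSet (F : Set (Point k l)) : Prop := (⋃ p ∈ F, IPlus μ m p) = F

/-- The past sets `I⁻(xₙ)` converge to the open past set `P`. -/
def PastsConverge (s : ℕ → Point k l) (P : Set (Point k l)) : Prop :=
  IsOpen P ∧ IsPastSet μ m P ∧
    (∀ p ∈ P, ∀ᶠ n in atTop, p ∈ IMinus μ m (s n)) ∧
    (∀ p ∉ closure P, ∀ᶠ n in atTop, p ∉ closure (IMinus μ m (s n)))

/-- The future sets `I⁺(xₙ)` converge to the open future set `F`. -/
def FuturesConverge (s : ℕ → Point k l) (F : Set (Point k l)) : Prop :=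
  IsOpen F ∧ IsFutureSet μ m F ∧
    (∀ p ∈ F, ∀ᶠ n in atTop, p ∈ IPlus μ m (s n)) ∧
    (∀ p ∉ closure F, ∀ᶠ n in atTop, p ∉ closure (IPlus μ m (s n)))

end Causality

section Classes

variable {k l : ℕ}

/-- The quotient `a / b` in the extended real line: `a / 0 = ±∞` (with the sign of `a`) for
`a ≠ 0`, and `0 / 0 = 0`. -/
noncomputable def extRatio (a b : ℝ) : EReal :=
  if b = 0 then (if a = 0 then 0 else if 0 < a then ⊤ else ⊥) else ((a / b : ℝ) : EReal)

/-- All coordinate sequences converge in `[-∞, +∞]`. -/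
def ClassZero (s : ℕ → Point k l) : Prop :=
  (∃ L : EReal, Tendsto (fun n => (xp (s n) : EReal)) atTop (𝓝 L)) ∧
  (∃ L : EReal, Tendsto (fun n => (xm (s n) : EReal)) atTop (𝓝 L)) ∧
  ∀ j, ∃ L : EReal, Tendsto (fun n => (tr (s n) j : EReal)) atTop (𝓝 L)

/-- The sequence has a limit point in the spacetime. -/
def ClassM (s : ℕ → Point k l) : Prop := ∃ p, MapClusterPt p atTop s

/-- The ratios `(xⁱ)² / x⁻`, `(yᵃ)² / x⁻` converge to the finite real numbers `c j`. -/
def RatioLimits (s : ℕ → Point k l) (c : Fin k ⊕ Fin l → ℝ) : Prop :=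
  ∀ j, Tendsto (fun n => extRatio (tr (s n) j ^ 2) (xm (s n))) atTop (𝓝 (c j : EReal))

/-- The class `C₁`. -/
def ClassOne (s : ℕ → Point k l) : Prop :=
  ClassZero s ∧ ¬ ClassM s ∧ ∃ c, RatioLimits s c

/-- The class `C₁⁺`. -/
def ClassOnePos (s : ℕ → Point k l) : Prop := ClassOne s ∧ ∀ n, 0 < xm (s n)

/-- The class `C₁⁻`. -/
def ClassOneNeg (s : ℕ → Point k l) : Prop := ClassOne s ∧ ∀ n, xm (s n) < 0

/-- The exceptional class: the ratios of any two transverse coordinates converge in `[-∞, +∞]`,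
and at least one of the ratios `(xⁱ)² / x⁻`, `(yᵃ)² / x⁻` diverges to `±∞`. -/
def ClassExcept (s : ℕ → Point k l) : Prop :=
  ClassZero s ∧ ¬ ClassM s ∧
  (∀ i j, i ≠ j →
    ∃ L : EReal, Tendsto (fun n => extRatio (tr (s n) i) (tr (s n) j)) atTop (𝓝 L)) ∧
  ∃ j, Tendsto (fun n => extRatio (tr (s n) j ^ 2) (xm (s n))) atTop (𝓝 ⊤) ∨
    Tendsto (fun n => extRatio (tr (s n) j ^ 2) (xm (s n))) atTop (𝓝 ⊥)

/-- The degenerate sequences on the axis `x⁻ = 0`, `xⁱ = 0`, `yᵃ = 0` with `x⁺ → ±∞`. -/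
def AxisEscape (s : ℕ → Point k l) : Prop :=
  (∀ n, xm (s n) = 0 ∧ ∀ j, tr (s n) j = 0) ∧
  (Tendsto (fun n => xp (s n)) atTop atTop ∨ Tendsto (fun n => xp (s n)) atTop atBot)

/-- The transverse coordinate `z` is a most rapidly growing one: every transverse coordinate
`w` has a finite normalized limit `r w = lim wₙ / zₙ`. -/
def Dominant (s : ℕ → Point k l) (z : Fin k ⊕ Fin l) (r : Fin k ⊕ Fin l → ℝ) : Prop :=
  ∀ j, Tendsto (fun n => extRatio (tr (s n) j) (tr (s n) z)) atTop (𝓝 (r j : EReal))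

end Classes

section Widths

variable {k l : ℕ} (μ : Fin k → ℝ) (m : Fin l → ℝ)

/-- `m coth (m δ)`, read as its limit `1 / δ` for a flat direction `m = 0`. -/
noncomputable def mcoth (m δ : ℝ) : ℝ :=
  if m = 0 then 1 / δ else m * (Real.cosh (m * δ) / Real.sinh (m * δ))

/-- The weighted sum `∑ μᵢ wᵢ cot (μᵢ δ) + ∑ mₐ wₐ coth (mₐ δ)`. -/
noncomputable def cotSum (w : Fin k ⊕ Fin l → ℝ) (δ : ℝ) : ℝ :=
  ∑ i, μ i * w (Sum.inl i) * Real.cot (μ i * δ) + ∑ a, w (Sum.inr a) * mcoth (m a) δ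

/-- `δ` is the smaller of `π / μ₁` and the smallest positive solution of
`r = ∑ μᵢ wᵢ cot (μᵢ δ) + ∑ mₐ wₐ coth (mₐ δ)` (just `π / μ₁` if there is no solution).
In the degenerate case `r > 0` and `w = 0` the solution is read as `δ = 0`, its limit as the
nonnegative weights tend to zero. -/
def IsDelta [NeZero k] (r : ℝ) (w : Fin k ⊕ Fin l → ℝ) (δ : ℝ) : Prop :=
  ((0 < r ∧ ∀ j, w j = 0) ∧ δ = 0) ∨
  (¬ (0 < r ∧ ∀ j, w j = 0) ∧
    IsLeast (insert (Real.pi / μ 0) {d : ℝ | 0 < d ∧ r = cotSum μ m w d}) δ)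

end Widths

end PlaneWave

open PlaneWave

/-! Parametrise a future timelike curve by `x⁺`. Timelikeness then reads `2 dx⁻/dx⁺ > ∑ⱼ (wⱼ'² - κⱼ
wⱼ²)`, where `κⱼ` is `μᵢ²` or `-mₐ²`. So `p ≪ q` asks whether `2 (x⁻(q) - x⁻(p))` exceeds the action
of some transverse path from `p` to `q` in time `δ = x⁺(q) - x⁺(p)`. The action is that of decoupled
oscillators. For `0 < δ < π/μ₁` its extremals are Jacobi fields, with value `∑ⱼ ((wⱼ(p)² + wⱼ(q)²)
cs δ / sn δ - 2 wⱼ(p) wⱼ(q) cs 0 / sn δ)`. Past `π/μ₁` it is unbounded below, so every pair is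
related (`chron_of_long`).

Sufficiency comes from lifting an extremal (`chron_of_jacobi`). Necessity comes from a calibration:
`∑ⱼ wⱼ² cs τ / sn τ` solves the Hamilton-Jacobi equation, hence bounds the action from below
(`Chron.action_le`).

For a sequence without limit point and with `x⁺` convergent, divide these inequalities by a scale
`Nₙ → ∞` for which `wⱼ²/Nₙ → cⱼ` and `2x⁻/Nₙ → r`. The terms involving the fixed point drop out, and
what remains is a comparison of `r` with `F_c` at the gap in `x⁺`. Since `F_c` decreases strictly
from `+∞` when `c ≠ 0`, the comparison switches exactly at `δ(r, c)`: the limit of the pasts is a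
half space (`pastsConverge_of_scaling`). The scales are `x⁻`, `-x⁻` and `z²` in the three classes,
with `r = 2, -2, 0`. Futures follow by time reversal, which replaces `r` by `-r`. The classification
is compactness of a product of extended real lines. -/

open PlaneWave
namespace PlaneWave
-- Jacobi fields of the transverse oscillators.
section Jacobi

variable {k l : ℕ} (μ : Fin k → ℝ) (m : Fin l → ℝ)

/-- The potential of the transverse direction `j`: `μᵢ²` or `-mₐ²`. -/
def kap : Fin k ⊕ Fin l → ℝ := Sum.elim (fun i => μ i ^ 2) (fun a => -m a ^ 2)

/-- A Jacobi field in the transverse direction `j` that vanishes at `0`. -/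
noncomputable def sn : Fin k ⊕ Fin l → ℝ → ℝ :=
  Sum.elim (fun i τ => Real.sin (μ i * τ))
    (fun a τ => if m a = 0 then τ else Real.sinh (m a * τ))

/-- The derivative of the Jacobi field `sn`. -/
noncomputable def cs : Fin k ⊕ Fin l → ℝ → ℝ :=
  Sum.elim (fun i τ => μ i * Real.cos (μ i * τ))
    (fun a τ => if m a = 0 then 1 else m a * Real.cosh (m a * τ))

lemma sn_zero (j : Fin k ⊕ Fin l) : sn μ m j 0 = 0 := by
  rcases j with i | a <;> simp [sn]

lemma hasDerivAt_sn (j : Fin k ⊕ Fin l) (τ : ℝ) : HasDerivAt (sn μ m j) (cs μ m j τ) τ := by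
  rcases j with i | a
  · have := ((hasDerivAt_id τ).const_mul (μ i)).sin
    simpa [sn, cs, mul_comm] using this
  · by_cases h : m a = 0
    · simpa [sn, cs, h] using hasDerivAt_id' τ
    · have := ((hasDerivAt_id τ).const_mul (m a)).sinh
      simpa [sn, cs, h, mul_comm] using this

lemma hasDerivAt_cs (j : Fin k ⊕ Fin l) (τ : ℝ) :
    HasDerivAt (cs μ m j) (-kap μ m j * sn μ m j τ) τ := by
  rcases j with i | a
  · have := (((hasDerivAt_id τ).const_mul (μ i)).cos).const_mul (μ i)
    simp only [cs, sn, kap, Sum.elim_inl]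
    refine this.congr_deriv ?_
    simp
    ring
  · by_cases h : m a = 0
    · simpa [sn, cs, kap, h] using hasDerivAt_const τ (1 : ℝ)
    · have := (((hasDerivAt_id τ).const_mul (m a)).cosh).const_mul (m a)
      simp only [cs, sn, kap, Sum.elim_inr, h, if_false]
      refine this.congr_deriv ?_
      simp
      ring

/-- Conservation of energy. The constant is kept as `cs 0 ^ 2` because `sn` is not normalised to
unit slope. -/
lemma cs_sq_add (j : Fin k ⊕ Fin l) (τ : ℝ) :
    cs μ m j τ ^ 2 + kap μ m j * sn μ m j τ ^ 2 = cs μ m j 0 ^ 2 := by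
  rcases j with i | a
  · have := Real.sin_sq_add_cos_sq (μ i * τ)
    simp only [cs, sn, kap, Sum.elim_inl, mul_zero, Real.cos_zero, mul_one]
    linear_combination μ i ^ 2 * this
  · by_cases h : m a = 0
    · simp [sn, cs, kap, h]
    · have := Real.cosh_sq_sub_sinh_sq (m a * τ)
      simp only [cs, sn, kap, Sum.elim_inr, h, if_false, mul_zero, Real.cosh_zero, mul_one]
      linear_combination m a ^ 2 * this

variable {μ m}

lemma cs_zero_pos (hμ : ∀ i, 0 < μ i) (hm : ∀ a, 0 ≤ m a) (j : Fin k ⊕ Fin l) :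
    0 < cs μ m j 0 := by
  rcases j with i | a
  · simpa [cs] using hμ i
  · by_cases h : m a = 0
    · simp [cs, h]
    · simpa [cs, h] using lt_of_le_of_ne (hm a) (Ne.symm h)

/-- `μ 0` is the largest frequency, so no direction focuses before `π / μ 0`; the directions `yᵃ`
never focus. -/
lemma sn_pos [NeZero k] (hμ : ∀ i, 0 < μ i) (hanti : Antitone μ) (hm : ∀ a, 0 ≤ m a)
    (j : Fin k ⊕ Fin l) {τ : ℝ} (h0 : 0 < τ) (h1 : τ < Real.pi / μ 0) : 0 < sn μ m j τ := by
  rw [lt_div_iff₀ (hμ 0)] at h1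
  rcases j with i | a
  · have h2 : μ i * τ ≤ μ 0 * τ := mul_le_mul_of_nonneg_right (hanti (Fin.zero_le i)) h0.le
    exact Real.sin_pos_of_pos_of_lt_pi (mul_pos (hμ i) h0) (by linarith)
  · by_cases h : m a = 0
    · simpa [sn, h] using h0
    · have := lt_of_le_of_ne (hm a) (Ne.symm h)
      simpa [sn, h] using mul_pos this h0

lemma cotSum_eq (w : Fin k ⊕ Fin l → ℝ) (d : ℝ) :
    cotSum μ m w d = ∑ j, w j * (cs μ m j d / sn μ m j d) := by
  rw [cotSum, Fintype.sum_sum_type]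
  congr 1
  · refine Finset.sum_congr rfl fun i _ => ?_
    simp only [cs, sn, Sum.elim_inl, Real.cot_eq_cos_div_sin]
    ring
  · refine Finset.sum_congr rfl fun a _ => ?_
    by_cases h : m a = 0 <;> simp [cs, sn, mcoth, h, mul_div_assoc]

lemma continuous_sn (j : Fin k ⊕ Fin l) : Continuous (sn μ m j) :=
  continuous_iff_continuousAt.2 fun τ => (hasDerivAt_sn μ m j τ).continuousAt

lemma continuous_cs (j : Fin k ⊕ Fin l) : Continuous (cs μ m j) :=
  continuous_iff_continuousAt.2 fun τ => (hasDerivAt_cs μ m j τ).continuousAt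

/-- The logarithmic derivative of a Jacobi field obeys the Riccati equation; this is the
Hamilton-Jacobi equation for `w² cs / sn`. -/
lemma hasDerivAt_cs_div_sn (j : Fin k ⊕ Fin l) {τ : ℝ} (h : sn μ m j τ ≠ 0) :
    HasDerivAt (fun τ => cs μ m j τ / sn μ m j τ)
      (-(cs μ m j τ / sn μ m j τ) ^ 2 - kap μ m j) τ := by
  refine ((hasDerivAt_cs μ m j τ).div (hasDerivAt_sn μ m j τ) h).congr_deriv ?_
  field_simp
  ring

end Jacobi

/-! ### Timelike curves from transverse paths of small action. -/

section Paths

variable {k l : ℕ} {μ : Fin k → ℝ} {m : Fin l → ℝ}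

lemma metric_self (p v : Point k l) :
    metric μ m p v v = -2 * (xp v * xm v) - (∑ j, kap μ m j * tr p j ^ 2) * xp v ^ 2
      + ∑ j, tr v j ^ 2 := by
  simp only [metric, Fintype.sum_sum_type, kap, tr, Sum.elim_inl, Sum.elim_inr, neg_mul,
    Finset.sum_neg_distrib, pow_two]
  ring

/-- A transverse path whose action is less than the gap in `x⁻` lifts to a timelike curve. -/
lemma chron_of_path {p q : Point k l} {δ : ℝ} (hδ : 0 < δ) (hpq : xp q - xp p = δ)
    (f g h e : Fin k ⊕ Fin l → ℝ → ℝ)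
    (hf : ∀ j τ, HasDerivAt (f j) (g j τ) τ) (hg : ∀ j, Continuous (g j))
    (hh : ∀ j τ, HasDerivAt (h j) (e j τ) τ) (he : ∀ j, Continuous (e j))
    (hle : ∀ j τ, g j τ ^ 2 - kap μ m j * f j τ ^ 2 ≤ 2 * e j τ)
    (hf0 : ∀ j, f j 0 = tr p j) (hf1 : ∀ j, f j δ = tr q j)
    (hlt : ∑ j, (h j δ - h j 0) < xm q - xm p) : Chron μ m p q := by
  -- The slack in the action inequality, spent at a constant rate along the curve so that it is
  -- strictly timelike everywhere.
  set σ := xm q - xm p - ∑ j, (h j δ - h j 0) with hσ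
  have hσ0 : 0 < σ := by linarith
  let γ : ℝ → Point k l := fun t => (xp p + δ * t, xm p + ∑ j, (h j (δ * t) - h j 0) + σ * t,
    fun i => f (Sum.inl i) (δ * t), fun a => f (Sum.inr a) (δ * t))
  let γ' : ℝ → Point k l := fun t => (δ, ∑ j, (e j (δ * t) * δ) + σ,
    fun i => g (Sum.inl i) (δ * t) * δ, fun a => g (Sum.inr a) (δ * t) * δ)
  have hlin : ∀ t, HasDerivAt (fun t : ℝ => δ * t) δ t := fun t => by
    simpa using (hasDerivAt_id t).const_mul δ
  have hσl : ∀ t, HasDerivAt (fun t : ℝ => σ * t) σ t := fun t => by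
    simpa using (hasDerivAt_id t).const_mul σ
  have hfd : ∀ j t, HasDerivAt (fun t => f j (δ * t)) (g j (δ * t) * δ) t := fun j t =>
    (hf j (δ * t)).comp t (hlin t)
  have hγ : ∀ t, HasDerivAt γ (γ' t) t := by
    intro t
    refine ((hlin t).const_add _).prodMk (HasDerivAt.prodMk ?_ (HasDerivAt.prodMk ?_ ?_))
    · refine HasDerivAt.add (HasDerivAt.const_add _ ?_) (hσl t)
      refine HasDerivAt.fun_sum fun j _ => ?_
      exact ((hh j (δ * t)).comp t (hlin t)).sub_const _
    · exact hasDerivAt_pi.2 fun i => hfd (Sum.inl i) t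
    · exact hasDerivAt_pi.2 fun a => hfd (Sum.inr a) t
  have hd : deriv γ = γ' := funext fun t => (hγ t).deriv
  have hc : Continuous γ' := by
    have hcj : ∀ j, Continuous fun t => e j (δ * t) := fun j =>
      (he j).comp (continuous_const.mul continuous_id)
    have hgj : ∀ j, Continuous fun t => g j (δ * t) := fun j =>
      (hg j).comp (continuous_const.mul continuous_id)
    refine continuous_const.prodMk (Continuous.prodMk ?_ (Continuous.prodMk ?_ ?_))
    · exact (continuous_finsetSum _ fun j _ => (hcj j).mul continuous_const).add continuous_const
    · exact continuous_pi fun i => (hgj _).mul continuous_const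
    · exact continuous_pi fun i => (hgj _).mul continuous_const
  refine ⟨γ, ?_, ?_, ?_, ?_⟩
  · rw [contDiff_one_iff_deriv, hd]
    exact ⟨fun t => (hγ t).differentiableAt, hc⟩
  · refine Prod.ext ?_ (Prod.ext ?_ (Prod.ext ?_ ?_))
    · simp [γ, xp]
    · simp [γ, xm]
    · funext i; simpa [γ, tr, xi, ya] using hf0 (Sum.inl i)
    · funext a; simpa [γ, tr, xi, ya] using hf0 (Sum.inr a)
  · refine Prod.ext ?_ (Prod.ext ?_ (Prod.ext ?_ ?_))
    · change xp p + δ * 1 = xp q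
      linarith
    · change xm p + ∑ j, (h j (δ * 1) - h j 0) + σ * 1 = xm q
      rw [mul_one, hσ]; ring
    · funext i; simpa [γ, tr, xi, ya] using hf1 (Sum.inl i)
    · funext a; simpa [γ, tr, xi, ya] using hf1 (Sum.inr a)
  · intro t _
    rw [hd]
    refine ⟨?_, hδ⟩
    have h1 : ∀ j, tr (γ t) j = f j (δ * t) := by rintro (i | a) <;> rfl
    have h2 : ∀ j, tr (γ' t) j = g j (δ * t) * δ := by rintro (i | a) <;> rfl
    have h3 : xp (γ' t) = δ := rfl
    have h4 : xm (γ' t) = ∑ j, (e j (δ * t) * δ) + σ := rfl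
    rw [metric_self, h3, h4]
    simp only [h1, h2]
    have h5 : -2 * (δ * (∑ j, (e j (δ * t) * δ) + σ))
        - (∑ j, kap μ m j * f j (δ * t) ^ 2) * δ ^ 2 + ∑ j, (g j (δ * t) * δ) ^ 2
        = -2 * δ * σ + δ ^ 2 * ∑ j, (g j (δ * t) ^ 2 - kap μ m j * f j (δ * t) ^ 2
          - 2 * e j (δ * t)) := by
      simp only [Finset.sum_sub_distrib, mul_pow, ← Finset.sum_mul, ← Finset.mul_sum]
      ring
    rw [h5]
    have h6 : ∑ j, (g j (δ * t) ^ 2 - kap μ m j * f j (δ * t) ^ 2 - 2 * e j (δ * t)) ≤ 0 :=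
      Finset.sum_nonpos fun j _ => by linarith [hle j (δ * t)]
    nlinarith [mul_pos hδ hσ0, mul_nonpos_of_nonneg_of_nonpos (sq_nonneg δ) h6]

/-- A gap in `x⁻` exceeding the action of the extremals of a weaker potential is timelike. -/
lemma chron_of_jacobi {ν : Fin k → ℝ} (hν : ∀ i, ν i ^ 2 ≤ μ i ^ 2) {p q : Point k l} {δ : ℝ}
    (hδ : 0 < δ) (hpq : xp q - xp p = δ) (hsn : ∀ j, sn ν m j δ ≠ 0)
    (hlt : ∑ j, ((tr p j ^ 2 + tr q j ^ 2) * (cs ν m j δ / sn ν m j δ)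
      - 2 * (tr p j * tr q j) * (cs ν m j 0 / sn ν m j δ)) < 2 * (xm q - xm p)) :
    Chron μ m p q := by
  -- The extremal with the prescribed endpoints, a combination of the Jacobi fields vanishing at
  -- either end.
  let f : Fin k ⊕ Fin l → ℝ → ℝ := fun j τ =>
    (tr p j * sn ν m j (δ - τ) + tr q j * sn ν m j τ) / sn ν m j δ
  let g : Fin k ⊕ Fin l → ℝ → ℝ := fun j τ =>
    (-(tr p j * cs ν m j (δ - τ)) + tr q j * cs ν m j τ) / sn ν m j δ
  have hrev : ∀ τ, HasDerivAt (fun τ => δ - τ) (-1) τ := fun τ => by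
    simpa using (hasDerivAt_id τ).const_sub δ
  have hf : ∀ j τ, HasDerivAt (f j) (g j τ) τ := fun j τ => by
    have h1 := (hasDerivAt_sn ν m j (δ - τ)).comp τ (hrev τ)
    have := ((h1.const_mul (tr p j)).add
      ((hasDerivAt_sn ν m j τ).const_mul (tr q j))).div_const (sn ν m j δ)
    refine this.congr_deriv ?_
    simp only [g]
    ring
  have hg : ∀ j τ, HasDerivAt (g j) (-kap ν m j * f j τ) τ := fun j τ => by
    have h1 := (hasDerivAt_cs ν m j (δ - τ)).comp τ (hrev τ)
    have := ((h1.const_mul (tr p j)).neg.add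
      ((hasDerivAt_cs ν m j τ).const_mul (tr q j))).div_const (sn ν m j δ)
    refine this.congr_deriv ?_
    simp only [f]
    ring
  have hfc : ∀ j, Continuous (f j) := fun j =>
    continuous_iff_continuousAt.2 fun τ => (hf j τ).continuousAt
  have hgc : ∀ j, Continuous (g j) := fun j =>
    continuous_iff_continuousAt.2 fun τ => (hg j τ).continuousAt
  have hkap : ∀ j, kap ν m j ≤ kap μ m j := by
    rintro (i | a)
    · exact hν i
    · exact le_rfl
  -- On an extremal the Lagrangian is the exact derivative `(f g)' = g² - κ f²`, so the action is a
  -- boundary term. Using `ν` instead of `μ` only increases the Lagrangian.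
  refine chron_of_path hδ hpq f g (fun j τ => f j τ * g j τ / 2)
    (fun j τ => (g j τ ^ 2 - kap ν m j * f j τ ^ 2) / 2) hf hgc (fun j τ => ?_) (fun j => ?_)
    (fun j τ => ?_) (fun j => ?_) (fun j => ?_) ?_
  · refine (((hf j τ).mul (hg j τ)).div_const 2).congr_deriv ?_
    ring
  · exact (((hgc j).pow 2).sub (continuous_const.mul ((hfc j).pow 2))).div_const 2
  · nlinarith [mul_le_mul_of_nonneg_right (hkap j) (sq_nonneg (f j τ))]
  · simp [f, sn_zero, hsn j]
  · simp [f, sn_zero, hsn j]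
  · have h1 : ∀ j, f j δ * g j δ / 2 - f j 0 * g j 0 / 2
        = ((tr p j ^ 2 + tr q j ^ 2) * (cs ν m j δ / sn ν m j δ)
          - 2 * (tr p j * tr q j) * (cs ν m j 0 / sn ν m j δ)) / 2 := fun j => by
      have := hsn j
      simp only [f, g, sub_self, sub_zero, sn_zero]
      field_simp
      ring
    simp only [h1, ← Finset.sum_div]
    linarith

/-- Beyond the focal distance every pair of points is chronologically related. -/
lemma chron_of_long [NeZero k] (hμ : ∀ i, 0 < μ i) {p q : Point k l}
    (hpq : Real.pi / μ 0 < xp q - xp p) : Chron μ m p q := by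
  obtain ⟨δ, hδe⟩ : ∃ δ, xp q - xp p = δ := ⟨_, rfl⟩
  rw [hδe] at hpq
  have hδ : 0 < δ := lt_trans (div_pos Real.pi_pos (hμ 0)) hpq
  -- The mode `sin (ν τ)` vanishes at both ends, and `ν < μ 0` gives it negative action in direction
  -- `0`. A large multiple added to the straight path `b` makes the action as negative as desired.
  obtain ⟨ν, hν⟩ : ∃ ν, Real.pi / δ = ν := ⟨_, rfl⟩
  have hν0 : 0 < ν := hν ▸ div_pos Real.pi_pos hδ
  have hνδ : ν * δ = Real.pi := by rw [← hν]; field_simp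
  have hνμ : ν < μ 0 := by
    rw [← hν, div_lt_iff₀ hδ]; rwa [div_lt_iff₀ (hμ 0), mul_comm] at hpq
  obtain ⟨β, hβ⟩ : ∃ β : Fin k ⊕ Fin l → ℝ, ∀ j, β j * δ = tr q j - tr p j :=
    ⟨fun j => (tr q j - tr p j) / δ, fun j => by field_simp⟩
  let b : Fin k ⊕ Fin l → ℝ → ℝ := fun j τ => tr p j + β j * τ
  let ι : Fin k ⊕ Fin l → ℝ := fun j => if j = Sum.inl 0 then 1 else 0
  -- Coefficients `e0`, `e1`, `e2` of half the Lagrangian as a quadratic polynomial in the amplitude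
  -- `c` of the added mode. Only the sign of the integrated leading one matters.
  let e0 : Fin k ⊕ Fin l → ℝ → ℝ := fun j τ => (β j ^ 2 - kap μ m j * b j τ ^ 2) / 2
  let e1 : Fin k ⊕ Fin l → ℝ → ℝ := fun j τ =>
    ι j * (β j * (ν * Real.cos (ν * τ)) - kap μ m j * b j τ * Real.sin (ν * τ))
  let e2 : Fin k ⊕ Fin l → ℝ → ℝ := fun j τ => ι j ^ 2 *
    ((ν * Real.cos (ν * τ)) ^ 2 - kap μ m j * Real.sin (ν * τ) ^ 2) / 2
  have hanti : ∀ e : ℝ → ℝ, Continuous e → ∃ h : ℝ → ℝ, ∀ τ, HasDerivAt h (e τ) τ := fun e he =>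
    ⟨fun τ => ∫ x in (0 : ℝ)..τ, e x, fun τ => (he.integral_hasStrictDerivAt 0 τ).hasDerivAt⟩
  have hbc : ∀ j, Continuous (b j) := fun j => by fun_prop
  have he0 : ∀ j, Continuous (e0 j) := fun j => by fun_prop
  have he1 : ∀ j, Continuous (e1 j) := fun j => by fun_prop
  have he2 : ∀ j, Continuous (e2 j) := fun j => by fun_prop
  choose h0 hh0 using fun j => hanti (e0 j) (he0 j)
  choose h1 hh1 using fun j => hanti (e1 j) (he1 j)
  let h2 : Fin k ⊕ Fin l → ℝ → ℝ := fun j τ => ι j ^ 2 *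
    ((ν ^ 2 - kap μ m j) * τ / 4
      + (ν ^ 2 + kap μ m j) * (Real.sin (ν * τ) * Real.cos (ν * τ)) / (4 * ν))
  have hlin : ∀ τ, HasDerivAt (fun τ : ℝ => ν * τ) ν τ := fun t => by
    simpa using (hasDerivAt_id t).const_mul ν
  have hh2 : ∀ j τ, HasDerivAt (h2 j) (e2 j τ) τ := fun j τ => by
    have := ((((hasDerivAt_id τ).const_mul (ν ^ 2 - kap μ m j)).div_const 4).add
      (((((hlin τ).sin.mul (hlin τ).cos).const_mul (ν ^ 2 + kap μ m j)).div_const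
        (4 * ν)))).const_mul (ι j ^ 2)
    refine this.congr_deriv ?_
    simp only [e2]
    have hs := Real.sin_sq_add_cos_sq (ν * τ)
    have hs' : Real.sin (ν * τ) ^ 2 = 1 - Real.cos (ν * τ) ^ 2 := by linarith
    field_simp
    rw [hs']
    ring
  have hA2 : ∑ j, (h2 j δ - h2 j 0) = (ν ^ 2 - μ 0 ^ 2) * δ / 4 := by
    have : ∀ j, h2 j δ - h2 j 0 = if j = Sum.inl 0 then (ν ^ 2 - μ 0 ^ 2) * δ / 4 else 0 := by
      intro j
      by_cases hj : j = Sum.inl 0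
      · subst hj
        simp [h2, ι, hνδ, kap]
      · simp [h2, ι, hj]
    simp [this]
  have hneg : (ν ^ 2 - μ 0 ^ 2) * δ / 4 < 0 := by
    have : ν ^ 2 < μ 0 ^ 2 := by gcongr
    nlinarith
  obtain ⟨A0, hA0⟩ : ∃ A, ∑ j, (h0 j δ - h0 j 0) = A := ⟨_, rfl⟩
  obtain ⟨A1, hA1⟩ : ∃ A, ∑ j, (h1 j δ - h1 j 0) = A := ⟨_, rfl⟩
  obtain ⟨A2, hA2'⟩ : ∃ A, (ν ^ 2 - μ 0 ^ 2) * δ / 4 = A := ⟨_, rfl⟩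
  rw [hA2'] at hA2 hneg
  obtain ⟨c, hc⟩ : ∃ c, A0 + c * A1 + c ^ 2 * A2 < xm q - xm p := by
    have h1 : Tendsto (fun c : ℝ => A0 + c * (A1 + c * A2)) atTop atBot := by
      refine tendsto_atBot_add_const_left _ _ (tendsto_id.atTop_mul_atBot₀ ?_)
      exact tendsto_atBot_add_const_left _ _ (tendsto_id.atTop_mul_const_of_neg hneg)
    obtain ⟨c, hc⟩ := (h1.eventually (eventually_lt_atBot (xm q - xm p))).exists
    exact ⟨c, by linarith⟩
  refine chron_of_path hδ hδe (fun j τ => b j τ + c * (ι j * Real.sin (ν * τ)))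
    (fun j τ => β j + c * (ι j * (ν * Real.cos (ν * τ))))
    (fun j τ => h0 j τ + c * h1 j τ + c ^ 2 * h2 j τ)
    (fun j τ => e0 j τ + c * e1 j τ + c ^ 2 * e2 j τ) (fun j τ => ?_) (fun j => by fun_prop)
    (fun j τ => ((hh0 j τ).add ((hh1 j τ).const_mul c)).add ((hh2 j τ).const_mul (c ^ 2)))
    (fun j => by fun_prop) (fun j τ => ?_) (fun j => ?_) (fun j => ?_) ?_
  · have := (((hasDerivAt_id τ).const_mul (β j)).const_add (tr p j)).add
      (((hlin τ).sin.const_mul (ι j)).const_mul c)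
    refine this.congr_deriv ?_
    ring
  · refine le_of_eq ?_
    simp only [e0, e1, e2]
    ring
  · simp [b]
  · simp [b, hνδ, hβ j]
  · have : ∑ j, (h0 j δ + c * h1 j δ + c ^ 2 * h2 j δ - (h0 j 0 + c * h1 j 0 + c ^ 2 * h2 j 0))
        = A0 + c * A1 + c ^ 2 * A2 := by
      rw [← hA0, ← hA1, ← hA2, Finset.mul_sum, Finset.mul_sum, ← Finset.sum_add_distrib,
        ← Finset.sum_add_distrib]
      exact Finset.sum_congr rfl fun j _ => by ring
    rw [this]
    exact hc

end Paths

/-! ### Lower bound for the action by a Hamilton-Jacobi function. -/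

section Calibration

variable {k l : ℕ} {μ : Fin k → ℝ} {m : Fin l → ℝ}

lemma hasDerivAt_coords {γ : ℝ → Point k l} {v : Point k l} {t : ℝ} (h : HasDerivAt γ v t) :
    HasDerivAt (fun t => xp (γ t)) (xp v) t ∧ HasDerivAt (fun t => xm (γ t)) (xm v) t ∧
      ∀ j, HasDerivAt (fun t => tr (γ t) j) (tr v j) t := by
  have h1 : HasDerivAt (fun t => (γ t).1) v.1 t := by simpa using h.hasFDerivAt.fst.hasDerivAt
  have h2 : HasDerivAt (fun t => (γ t).2) v.2 t := by simpa using h.hasFDerivAt.snd.hasDerivAt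
  have h3 : HasDerivAt (fun t => (γ t).2.1) v.2.1 t := by
    simpa using h2.hasFDerivAt.fst.hasDerivAt
  have h4 : HasDerivAt (fun t => (γ t).2.2) v.2.2 t := by
    simpa using h2.hasFDerivAt.snd.hasDerivAt
  have h5 : HasDerivAt (fun t => (γ t).2.2.1) v.2.2.1 t := by
    simpa using h4.hasFDerivAt.fst.hasDerivAt
  have h6 : HasDerivAt (fun t => (γ t).2.2.2) v.2.2.2 t := by
    simpa using h4.hasFDerivAt.snd.hasDerivAt
  refine ⟨h1, h3, ?_⟩
  rintro (i | a)
  · exact (hasDerivAt_pi.1 h5) i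
  · exact (hasDerivAt_pi.1 h6) a

lemma Chron.xp_lt {p q : Point k l} (h : Chron μ m p q) : xp p < xp q := by
  obtain ⟨γ, hγ, h0, h1, ht⟩ := h
  have hd : ∀ t, HasDerivAt γ (deriv γ t) t := fun t =>
    (hγ.differentiable one_ne_zero t).hasDerivAt
  have hx := fun t => (hasDerivAt_coords (hd t)).1
  have := strictMonoOn_of_deriv_pos (convex_Icc (0 : ℝ) 1)
    (f := fun t => xp (γ t)) (fun t _ => (hx t).continuousAt.continuousWithinAt)
    (fun t ht' => by
      rw [(hx t).deriv]
      exact (ht t (interior_subset ht')).2)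
    (Set.left_mem_Icc.2 zero_le_one) (Set.right_mem_Icc.2 zero_le_one) zero_lt_one
  simpa [h0, h1] using this

/-- Lower bound for the gap in `x⁻` along a timelike curve, from a solution of the
Hamilton-Jacobi equation that is quadratic in the transverse coordinates. -/
lemma Chron.action_le [NeZero k] (hμ : ∀ i, 0 < μ i) (hanti : Antitone μ) (hm : ∀ a, 0 ≤ m a)
    {p q : Point k l} (h : Chron μ m p q) {ε : ℝ} (hε : 0 < ε)
    (hlt : xp q - xp p + ε < Real.pi / μ 0) :
    ∑ j, tr q j ^ 2 * (cs μ m j (xp q - xp p + ε) / sn μ m j (xp q - xp p + ε))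
      - ∑ j, tr p j ^ 2 * (cs μ m j ε / sn μ m j ε) ≤ 2 * (xm q - xm p) := by
  obtain ⟨γ, hγ, h0, h1, ht⟩ := h
  have hd : ∀ t, HasDerivAt γ (deriv γ t) t := fun t =>
    (hγ.differentiable one_ne_zero t).hasDerivAt
  have hx := fun t => (hasDerivAt_coords (hd t)).1
  have hxm := fun t => (hasDerivAt_coords (hd t)).2.1
  have htr := fun t => (hasDerivAt_coords (hd t)).2.2
  have hmono : MonotoneOn (fun t => xp (γ t)) (Set.Icc 0 1) :=
    monotoneOn_of_deriv_nonneg (convex_Icc (0 : ℝ) 1)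
      (fun t _ => (hx t).continuousAt.continuousWithinAt)
      (fun t _ => (hx t).differentiableAt.differentiableWithinAt)
      (fun t ht' => by
        rw [(hx t).deriv]
        exact (ht t (interior_subset ht')).2.le)
  -- The shift by `ε` keeps the time argument away from the pole of `cs / sn` at `0`.
  let T : ℝ → ℝ := fun t => xp (γ t) - xp p + ε
  have hT : ∀ t, HasDerivAt T (xp (deriv γ t)) t := fun t => ((hx t).sub_const _).add_const _
  have hsn : ∀ t ∈ Set.Icc (0 : ℝ) 1, ∀ j, 0 < sn μ m j (T t) := by
    intro t ht' j
    have h2 := hmono (Set.left_mem_Icc.2 zero_le_one) ht' ht'.1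
    have h3 := hmono ht' (Set.right_mem_Icc.2 zero_le_one) ht'.2
    simp only [h0, h1] at h2 h3
    exact sn_pos hμ hanti hm j (by simp only [T]; linarith) (by simp only [T]; linarith)
  let a : Fin k ⊕ Fin l → ℝ → ℝ := fun j τ => cs μ m j τ / sn μ m j τ
  let Ψ : ℝ → ℝ := fun t => 2 * xm (γ t) - ∑ j, tr (γ t) j ^ 2 * a j (T t)
  have hΨ : ∀ t ∈ Set.Icc (0 : ℝ) 1, HasDerivAt Ψ (2 * xm (deriv γ t)
      - ∑ j, (2 * tr (γ t) j * tr (deriv γ t) j * a j (T t)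
        + tr (γ t) j ^ 2 * ((-(a j (T t)) ^ 2 - kap μ m j) * xp (deriv γ t)))) t := by
    intro t ht'
    refine ((hxm t).const_mul 2).sub (HasDerivAt.fun_sum fun j _ => ?_)
    have h2 := (hasDerivAt_cs_div_sn j (hsn t ht' j).ne').comp t (hT t)
    refine (((htr t j).pow 2).mul h2).congr_deriv ?_
    simp [a]
  have hΨm : MonotoneOn Ψ (Set.Icc 0 1) := by
    refine monotoneOn_of_deriv_nonneg (convex_Icc (0 : ℝ) 1)
      (fun t ht' => (hΨ t ht').continuousAt.continuousWithinAt)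
      (fun t ht' => (hΨ t (interior_subset ht')).differentiableAt.differentiableWithinAt)
      (fun t ht' => ?_)
    have ht'' := interior_subset ht'
    rw [(hΨ t ht'').deriv]
    obtain ⟨hneg, hpos⟩ := ht t ht''
    rw [metric_self] at hneg
    set D := xp (deriv γ t)
    -- Completing the square: by the Riccati equation, `D` times the derivative of `Ψ` is minus the
    -- metric norm of the velocity plus a sum of squares, hence nonnegative.
    have key : D * (2 * xm (deriv γ t)
        - ∑ j, (2 * tr (γ t) j * tr (deriv γ t) j * a j (T t)
          + tr (γ t) j ^ 2 * ((-(a j (T t)) ^ 2 - kap μ m j) * D)))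
        = -(-2 * (D * xm (deriv γ t)) - (∑ j, kap μ m j * tr (γ t) j ^ 2) * D ^ 2
          + ∑ j, tr (deriv γ t) j ^ 2)
          + ∑ j, (tr (deriv γ t) j - a j (T t) * D * tr (γ t) j) ^ 2 := by
      have e1 : ∑ j, (tr (deriv γ t) j - a j (T t) * D * tr (γ t) j) ^ 2
          = ∑ j, tr (deriv γ t) j ^ 2 - (∑ j, kap μ m j * tr (γ t) j ^ 2) * D ^ 2
            - D * ∑ j, (2 * tr (γ t) j * tr (deriv γ t) j * a j (T t)
              + tr (γ t) j ^ 2 * ((-(a j (T t)) ^ 2 - kap μ m j) * D)) := by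
        rw [Finset.sum_mul, Finset.mul_sum, ← Finset.sum_sub_distrib, ← Finset.sum_sub_distrib]
        exact Finset.sum_congr rfl fun j _ => by ring
      rw [e1]
      ring
    have hsq : 0 ≤ ∑ j, (tr (deriv γ t) j - a j (T t) * D * tr (γ t) j) ^ 2 :=
      Finset.sum_nonneg fun j _ => sq_nonneg _
    by_contra hcon
    push Not at hcon
    have := mul_neg_of_pos_of_neg hpos hcon
    linarith
  have := hΨm (Set.left_mem_Icc.2 zero_le_one) (Set.right_mem_Icc.2 zero_le_one) zero_le_one
  simp only [Ψ, T, h0, h1, sub_self, zero_add, a] at this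
  linarith

end Calibration
end PlaneWave

namespace PlaneWave
-- Time reversal exchanges pasts and futures.
section Reflection

variable {k l : ℕ} {μ : Fin k → ℝ} {m : Fin l → ℝ}

/-- The time-reversing isometry `(x⁺, x⁻) ↦ (-x⁺, -x⁻)`. -/
def reflect (p : Point k l) : Point k l := (-xp p, -xm p, xi p, ya p)

@[simp] lemma xp_reflect (p : Point k l) : xp (reflect p) = -xp p := rfl

@[simp] lemma xm_reflect (p : Point k l) : xm (reflect p) = -xm p := rfl

@[simp] lemma tr_reflect (p : Point k l) : tr (reflect p) = tr p := rfl

@[simp] lemma reflect_reflect (p : Point k l) : reflect (reflect p) = p := by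
  simp [reflect, xp, xm, xi, ya]

lemma continuous_xp : Continuous (xp : Point k l → ℝ) := continuous_fst

lemma continuous_xm : Continuous (xm : Point k l → ℝ) := continuous_fst.comp continuous_snd

lemma continuous_tr (j : Fin k ⊕ Fin l) : Continuous fun p : Point k l => tr p j := by
  rcases j with i | a
  · exact (continuous_apply i).comp (continuous_fst.comp (continuous_snd.comp continuous_snd))
  · exact (continuous_apply a).comp (continuous_snd.comp (continuous_snd.comp continuous_snd))

lemma continuous_reflect : Continuous (reflect : Point k l → Point k l) :=
  continuous_xp.neg.prodMk (continuous_xm.neg.prodMk (continuous_snd.comp continuous_snd))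

/-- The time-reversing isometry as a homeomorphism. -/
def reflectHomeomorph : Point k l ≃ₜ Point k l where
  toFun := reflect
  invFun := reflect
  left_inv := reflect_reflect
  right_inv := reflect_reflect
  continuous_toFun := continuous_reflect
  continuous_invFun := continuous_reflect

lemma Chron.reflect {p q : Point k l} (h : Chron μ m p q) :
    Chron μ m (reflect q) (reflect p) := by
  obtain ⟨γ, hγ, h0, h1, ht⟩ := h
  have hd : ∀ t, HasDerivAt γ (deriv γ t) t := fun t =>
    (hγ.differentiable one_ne_zero t).hasDerivAt
  have hdc : Continuous (deriv γ) := hγ.continuous_deriv le_rfl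
  have hrev : ∀ t, HasDerivAt (fun t : ℝ => 1 - t) (-1) t := fun t => by
    simpa using (hasDerivAt_id t).const_sub 1
  -- Velocity of the reflected curve run backwards: the two signs cancel in `x⁺`, `x⁻` and only the
  -- reversal remains transversally.
  let σ : Point k l → Point k l := fun v => (xp v, xm v, -xi v, -ya v)
  have hσ : Continuous σ := continuous_xp.prodMk (continuous_xm.prodMk
    ((continuous_fst.comp (continuous_snd.comp continuous_snd)).neg.prodMk
      (continuous_snd.comp (continuous_snd.comp continuous_snd)).neg))
  have hR : ∀ t, HasDerivAt (fun t => PlaneWave.reflect (γ (1 - t))) (σ (deriv γ (1 - t))) t := by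
    intro t
    have hc := hasDerivAt_coords ((hd (1 - t)).scomp t (hrev t))
    refine (hc.1.neg.congr_deriv ?_).prodMk ((hc.2.1.neg.congr_deriv ?_).prodMk
      (HasDerivAt.prodMk (hasDerivAt_pi.2 fun i => (hc.2.2 (Sum.inl i)).congr_deriv ?_)
        (hasDerivAt_pi.2 fun i => (hc.2.2 (Sum.inr i)).congr_deriv ?_)))
    · simp [xp]
    · simp [xm]
    · simp [tr, xi]
    · simp [tr, ya]
  have hdR : deriv (fun t => PlaneWave.reflect (γ (1 - t))) = fun t => σ (deriv γ (1 - t)) :=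
    funext fun t => (hR t).deriv
  refine ⟨fun t => PlaneWave.reflect (γ (1 - t)), ?_, by simp [h1], by simp [h0], fun t h => ?_⟩
  · rw [contDiff_one_iff_deriv, hdR]
    exact ⟨fun t => (hR t).differentiableAt,
      hσ.comp (hdc.comp (continuous_const.sub continuous_id))⟩
  · obtain ⟨hneg, hpos⟩ := ht (1 - t) ⟨by linarith [h.2], by linarith [h.1]⟩
    rw [hdR]
    refine ⟨?_, hpos⟩
    rw [metric_self] at hneg ⊢
    have h2 : ∀ v j, tr (σ v) j ^ 2 = tr v j ^ 2 := by
      rintro v (i | a) <;> simp [σ, tr, xi, ya]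
    simp only [h2, tr_reflect]
    exact hneg

lemma chron_reflect_iff {p q : Point k l} :
    Chron μ m (reflect p) (reflect q) ↔ Chron μ m q p :=
  ⟨fun h => by simpa using h.reflect, Chron.reflect⟩

lemma iMinus_reflect (p : Point k l) : IMinus μ m (reflect p) = reflect ⁻¹' IPlus μ m p := by
  ext q
  rw [Set.mem_preimage, IMinus, IPlus, Set.mem_ofPred_eq, Set.mem_ofPred_eq]
  rw [← chron_reflect_iff, reflect_reflect]

lemma PastsConverge.futures {s : ℕ → Point k l} {P : Set (Point k l)}
    (h : PastsConverge μ m (reflect ∘ s) P) : FuturesConverge μ m s (reflect ⁻¹' P) := by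
  obtain ⟨ho, hp, h1, h2⟩ := h
  have hI : ∀ p : Point k l, IPlus μ m p = reflect ⁻¹' IMinus μ m (reflect p) := fun p => by
    rw [iMinus_reflect, ← Set.preimage_comp]
    ext q
    simp
  refine ⟨ho.preimage continuous_reflect, ?_, fun p hp' => ?_, fun p hp' => ?_⟩
  · rw [IsFutureSet]
    conv_rhs => rw [← hp]
    ext q
    simp only [Set.mem_iUnion, Set.mem_preimage, exists_prop, hI]
    constructor
    · rintro ⟨p, hp, hq⟩
      exact ⟨_, hp, hq⟩
    · rintro ⟨p, hp, hq⟩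
      exact ⟨reflect p, by simpa using hp, by simpa using hq⟩
  · filter_upwards [h1 _ hp'] with n hn
    rw [hI]
    exact hn
  · have hcl : ∀ S : Set (Point k l), closure (reflect ⁻¹' S) = reflect ⁻¹' closure S := fun S =>
      (reflectHomeomorph.preimage_closure S).symm
    rw [hcl] at hp'
    filter_upwards [h2 _ hp'] with n hn
    rw [hI, hcl]
    exact hn

end Reflection

/-! ### Half spaces in `x⁺` as limits of pasts and futures. -/

section HalfSpaces

variable {k l : ℕ} {μ : Fin k → ℝ} {m : Fin l → ℝ}

lemma isOpen_xp_lt (a : EReal) : IsOpen {p : Point k l | (xp p : EReal) < a} :=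
  isOpen_lt (continuous_coe_real_ereal.comp continuous_xp) continuous_const

lemma lt_xp_of_notMem_closure {a : EReal} {p : Point k l}
    (hp : p ∉ closure {p : Point k l | (xp p : EReal) < a}) : a < (xp p : EReal) := by
  by_contra hcon
  push Not at hcon
  refine hp (mem_closure_of_tendsto (b := 𝓝[>] (0 : ℝ))
    (f := fun ε => ((xp p - ε, p.2) : Point k l)) ?_ ?_)
  · have h : Continuous fun ε : ℝ => ((xp p - ε, p.2) : Point k l) :=
      (continuous_const.sub continuous_id).prodMk continuous_const
    have h2 := (h.tendsto 0).mono_left (nhdsWithin_le_nhds (s := Set.Ioi 0))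
    simpa [xp] using h2
  · filter_upwards [self_mem_nhdsWithin] with ε hε
    refine lt_of_lt_of_le ?_ hcon
    have : xp p - ε < xp p := sub_lt_self _ hε
    exact_mod_cast this

lemma isPastSet_xp_lt (a : EReal) : IsPastSet μ m {p : Point k l | (xp p : EReal) < a} := by
  ext q
  simp only [Set.mem_iUnion, Set.mem_ofPred_eq, exists_prop]
  constructor
  · rintro ⟨p, hp, hq⟩
    exact lt_trans (by exact_mod_cast hq.xp_lt) hp
  · intro hq
    obtain ⟨b, hb, hba⟩ := EReal.lt_iff_exists_real_btwn.1 hq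
    have hb' : 0 < b - xp q := sub_pos.2 (by exact_mod_cast hb)
    -- Half the Lagrangian of the path at rest at `q`. A target with the same transverse position
    -- and `x⁻` one more than this action allows lies in the future of `q`.
    let E : Fin k ⊕ Fin l → ℝ := fun j => -kap μ m j * tr q j ^ 2 / 2
    refine ⟨(b, xm q + ∑ j, (E j * (b - xp q) - E j * 0) + 1, xi q, ya q), hba, ?_⟩
    refine chron_of_path hb' rfl (fun j _ => tr q j) (fun _ _ => 0) (fun j τ => E j * τ)
      (fun j _ => E j) (fun j τ => hasDerivAt_const τ _) (fun _ => continuous_const)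
      (fun j τ => by simpa using (hasDerivAt_id τ).const_mul (E j)) (fun _ => continuous_const)
      (fun j τ => ?_) (fun _ => rfl) (fun j => rfl) ?_
    · refine le_of_eq ?_
      simp only [E]
      ring
    · change _ < xm q + _ + 1 - xm q
      linarith

/-- Exclusion from the closure of a past needs unrelatedness on a whole neighbourhood of `p`, hence
the product filter in `h2`. -/
lemma pastsConverge_xp_lt {s : ℕ → Point k l} {a : EReal}
    (h1 : ∀ p, (xp p : EReal) < a → ∀ᶠ n in atTop, Chron μ m p (s n))
    (h2 : ∀ p : Point k l, a < (xp p : EReal) →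
      ∀ᶠ x : ℕ × Point k l in atTop ×ˢ 𝓝 p, ¬ Chron μ m x.2 (s x.1)) :
    PastsConverge μ m s {p | (xp p : EReal) < a} := by
  refine ⟨isOpen_xp_lt a, isPastSet_xp_lt a, h1, fun p hp => ?_⟩
  filter_upwards [(h2 p (lt_xp_of_notMem_closure hp)).curry] with n hn hcl
  obtain ⟨q, hq, hq'⟩ := ((mem_closure_iff_frequently.1 hcl).and_eventually hn).exists
  exact hq' hq

lemma pastsConverge_of_tendsto_infinite [NeZero k] (hμ : ∀ i, 0 < μ i) {s : ℕ → Point k l}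
    {xt : EReal} (hxt : xt = ⊤ ∨ xt = ⊥)
    (hx : Tendsto (fun n => (xp (s n) : EReal)) atTop (𝓝 xt)) :
    PastsConverge μ m s {p | (xp p : EReal) < xt} := by
  rcases hxt with rfl | rfl
  · refine pastsConverge_xp_lt (fun p _ => ?_) (fun p hp => absurd hp not_top_lt)
    have := EReal.tendsto_coe_nhds_top_iff.1 hx
    filter_upwards [this.eventually_gt_atTop (xp p + Real.pi / μ 0)] with n hn
    exact chron_of_long hμ (by linarith)
  · refine pastsConverge_xp_lt (fun p hp => absurd hp not_lt_bot) (fun p _ => ?_)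
    have h1 := (EReal.tendsto_coe_nhds_bot_iff.1 hx).eventually_lt_atBot (xp p - 1)
    have h2 : ∀ᶠ q in 𝓝 p, xp p - 1 < xp q :=
      continuous_xp.continuousAt.eventually (lt_mem_nhds (by linarith))
    filter_upwards [h1.prod_mk h2] with x hx hc
    linarith [hc.xp_lt, hx.1, hx.2]

lemma futuresConverge_of_pasts {s : ℕ → Point k l} {a : EReal}
    (h : PastsConverge μ m (reflect ∘ s) {p | (xp p : EReal) < -a}) :
    FuturesConverge μ m s {p | a < (xp p : EReal)} := by
  have := h.futures
  have e : reflect ⁻¹' {p : Point k l | (xp p : EReal) < -a} = {p | a < (xp p : EReal)} := by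
    ext p
    simp only [Set.mem_preimage, Set.mem_ofPred_eq, xp_reflect, EReal.coe_neg, EReal.neg_lt_neg_iff]
  rwa [e] at this

end HalfSpaces

/-! ### Monotonicity of `cotSum` and the threshold `δ(r, w)`. -/

section Widths

variable {k l : ℕ} {μ : Fin k → ℝ} {m : Fin l → ℝ}

/-- By the Riccati equation and energy conservation the derivative of `cs / sn` is `-(cs 0 / sn
τ)²`. -/
lemma cs_div_sn_lt (hμ : ∀ i, 0 < μ i) (hm : ∀ a, 0 ≤ m a) (j : Fin k ⊕ Fin l) {d d' : ℝ}
    (hd : d < d') (hs : ∀ τ ∈ Set.Icc d d', sn μ m j τ ≠ 0) :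
    cs μ m j d' / sn μ m j d' < cs μ m j d / sn μ m j d := by
  have hder : ∀ τ ∈ Set.Icc d d', HasDerivAt (fun τ => cs μ m j τ / sn μ m j τ) _ τ :=
    fun τ hτ => hasDerivAt_cs_div_sn j (hs τ hτ)
  refine strictAntiOn_of_deriv_neg (convex_Icc d d')
    (fun τ hτ => (hder τ hτ).continuousAt.continuousWithinAt) (fun τ hτ => ?_)
    (Set.left_mem_Icc.2 hd.le) (Set.right_mem_Icc.2 hd.le) hd
  have hτ' := interior_subset hτ
  rw [(hder τ hτ').deriv]
  have h0 := hs τ hτ'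
  have h1 : -(cs μ m j τ / sn μ m j τ) ^ 2 - kap μ m j = -(cs μ m j 0 / sn μ m j τ) ^ 2 := by
    rw [div_pow, div_pow, ← cs_sq_add μ m j τ]
    field_simp
    ring
  rw [h1]
  have := div_ne_zero (cs_zero_pos hμ hm j).ne' h0
  have := sq_pos_of_ne_zero this
  linarith

lemma sn_ne_zero_of_mem_Icc [NeZero k] (hμ : ∀ i, 0 < μ i) (hanti : Antitone μ)
    (hm : ∀ a, 0 ≤ m a) (j : Fin k ⊕ Fin l) {d d' : ℝ} (h0 : 0 < d) (h1 : d' < Real.pi / μ 0) :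
    ∀ τ ∈ Set.Icc d d', sn μ m j τ ≠ 0 := fun _ hτ =>
  (sn_pos hμ hanti hm j (h0.trans_le hτ.1) (hτ.2.trans_lt h1)).ne'

lemma cotSum_lt [NeZero k] (hμ : ∀ i, 0 < μ i) (hanti : Antitone μ) (hm : ∀ a, 0 ≤ m a)
    {w : Fin k ⊕ Fin l → ℝ} (hw : ∀ j, 0 ≤ w j) (hw' : ∃ j, w j ≠ 0) {d d' : ℝ} (h0 : 0 < d)
    (hd : d < d') (h1 : d' < Real.pi / μ 0) : cotSum μ m w d' < cotSum μ m w d := by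
  have h : ∀ j, cs μ m j d' / sn μ m j d' < cs μ m j d / sn μ m j d := fun j =>
    cs_div_sn_lt hμ hm j hd (sn_ne_zero_of_mem_Icc hμ hanti hm j h0 h1)
  obtain ⟨j, hj⟩ := hw'
  rw [cotSum_eq, cotSum_eq]
  exact Finset.sum_lt_sum (fun i _ => mul_le_mul_of_nonneg_left (h i).le (hw i))
    ⟨j, Finset.mem_univ _, mul_lt_mul_of_pos_left (h j) (lt_of_le_of_ne (hw j) (Ne.symm hj))⟩

lemma continuousAt_cotSum {w : Fin k ⊕ Fin l → ℝ} {d : ℝ} (h : ∀ j, sn μ m j d ≠ 0) :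
    ContinuousAt (cotSum μ m w) d := by
  rw [show cotSum μ m w = _ from funext (cotSum_eq w)]
  exact tendsto_finsetSum _ fun j _ =>
    ((hasDerivAt_cs_div_sn j (h j)).continuousAt.tendsto).const_mul (w j)

lemma exists_lt_cotSum [NeZero k] (hμ : ∀ i, 0 < μ i) (hanti : Antitone μ) (hm : ∀ a, 0 ≤ m a)
    {w : Fin k ⊕ Fin l → ℝ} (hw : ∀ j, 0 ≤ w j) (hw' : ∃ j, w j ≠ 0) (r : ℝ) {η : ℝ}
    (hη : 0 < η) : ∃ d, 0 < d ∧ d < η ∧ r < cotSum μ m w d := by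
  have hπ : 0 < Real.pi / μ 0 := div_pos Real.pi_pos (hμ 0)
  have hsn : ∀ j, ∀ᶠ d in 𝓝[>] (0 : ℝ), 0 < sn μ m j d := fun j => by
    filter_upwards [Ioo_mem_nhdsGT hπ] with d hd
    exact sn_pos hμ hanti hm j hd.1 hd.2
  have hcs : ∀ j, ∀ᶠ d in 𝓝[>] (0 : ℝ), 0 < cs μ m j d := fun j =>
    nhdsWithin_le_nhds ((continuous_cs j).continuousAt.eventually
      (lt_mem_nhds (cs_zero_pos hμ hm j)))
  obtain ⟨j, hj⟩ := hw'
  have hj' := lt_of_le_of_ne (hw j) (Ne.symm hj)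
  have hlim : Tendsto (fun d => w j * (cs μ m j d / sn μ m j d)) (𝓝[>] 0) atTop := by
    refine Tendsto.const_mul_atTop hj' ?_
    have h1 : Tendsto (cs μ m j) (𝓝[>] 0) (𝓝 (cs μ m j 0)) :=
      ((continuous_cs j).tendsto 0).mono_left nhdsWithin_le_nhds
    have h2 : Tendsto (sn μ m j) (𝓝[>] 0) (𝓝[>] 0) := by
      refine tendsto_nhdsWithin_iff.2 ⟨?_, hsn j⟩
      have := ((continuous_sn (μ := μ) (m := m) j).tendsto 0).mono_left
        (nhdsWithin_le_nhds (s := Set.Ioi 0))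
      rwa [sn_zero] at this
    simpa only [div_eq_mul_inv, Function.comp_def] using
      h1.pos_mul_atTop (cs_zero_pos hμ hm j) (tendsto_inv_nhdsGT_zero.comp h2)
  have hIoo : ∀ᶠ d in 𝓝[>] 0, d ∈ Set.Ioo 0 η := Ioo_mem_nhdsGT hη
  obtain ⟨d, ⟨h1, h2⟩, h3, h4, h5⟩ := (hIoo.and
    ((hlim.eventually_gt_atTop r).and
      ((eventually_all.2 hsn).and (eventually_all.2 hcs)))).exists
  refine ⟨d, h1, h2, h3.trans_le ?_⟩
  rw [cotSum_eq]
  exact Finset.single_le_sum (f := fun j => w j * (cs μ m j d / sn μ m j d))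
    (fun i _ => mul_nonneg (hw i) (div_pos (h5 i) (h4 i)).le) (Finset.mem_univ j)

lemma cotSum_of_forall_eq_zero {w : Fin k ⊕ Fin l → ℝ} (hw : ∀ j, w j = 0) (d : ℝ) :
    cotSum μ m w d = 0 := by
  rw [cotSum_eq]
  exact Finset.sum_eq_zero fun j _ => by rw [hw j, zero_mul]

/-- Strict monotonicity leaves at most one solution below `π / μ 0`. The case `r = 0`, `w = 0` must
be excluded: every positive `d` is then a solution and there is no least one. -/
lemma exists_isDelta [NeZero k] (hμ : ∀ i, 0 < μ i) (hanti : Antitone μ) (hm : ∀ a, 0 ≤ m a)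
    {w : Fin k ⊕ Fin l → ℝ} (hw : ∀ j, 0 ≤ w j) {r : ℝ} (hr : r ≠ 0 ∨ ∃ j, w j ≠ 0) :
    ∃ δ, IsDelta μ m r w δ := by
  by_cases h0 : 0 < r ∧ ∀ j, w j = 0
  · exact ⟨0, Or.inl ⟨h0, rfl⟩⟩
  by_cases hw0 : ∀ j, w j = 0
  · refine ⟨Real.pi / μ 0, Or.inr ⟨h0, Set.mem_insert _ _, ?_⟩⟩
    rintro d (rfl | ⟨_, hd⟩)
    · exact le_rfl
    · rw [cotSum_of_forall_eq_zero hw0] at hd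
      rcases hr with hr | ⟨j, hj⟩
      · exact absurd hd hr
      · exact absurd (hw0 j) hj
  push Not at hw0
  by_cases hs : ∃ d, (0 < d ∧ r = cotSum μ m w d) ∧ d < Real.pi / μ 0
  · obtain ⟨d, hd, hdπ⟩ := hs
    refine ⟨d, Or.inr ⟨h0, Set.mem_insert_of_mem _ hd, ?_⟩⟩
    rintro d' (rfl | ⟨hd', he⟩)
    · exact hdπ.le
    · by_contra hlt
      push Not at hlt
      have := cotSum_lt hμ hanti hm hw hw0 hd' hlt hdπ
      linarith [hd.2]
  · push Not at hs
    refine ⟨Real.pi / μ 0, Or.inr ⟨h0, Set.mem_insert _ _, ?_⟩⟩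
    rintro d (rfl | hd)
    · exact le_rfl
    · exact hs d hd

lemma IsDelta.nonneg [NeZero k] (hμ : ∀ i, 0 < μ i) {w : Fin k ⊕ Fin l → ℝ} {r δ : ℝ}
    (h : IsDelta μ m r w δ) : 0 ≤ δ := by
  rcases h with ⟨_, rfl⟩ | ⟨_, h, _⟩
  · exact le_rfl
  · rcases h with rfl | h
    · exact (div_pos Real.pi_pos (hμ 0)).le
    · exact h.1.le

lemma IsDelta.le_pi_div [NeZero k] (hμ : ∀ i, 0 < μ i) {w : Fin k ⊕ Fin l → ℝ} {r δ : ℝ}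
    (h : IsDelta μ m r w δ) : δ ≤ Real.pi / μ 0 := by
  rcases h with ⟨_, rfl⟩ | ⟨_, _, h⟩
  · exact (div_pos Real.pi_pos (hμ 0)).le
  · exact h (Set.mem_insert _ _)

/-- For `w ≠ 0` the sum tends to `+∞` at `0⁺`, so a value at most `r` before `δ` would produce a
smaller solution by the intermediate value theorem. -/
lemma IsDelta.lt_cotSum [NeZero k] (hμ : ∀ i, 0 < μ i) (hanti : Antitone μ) (hm : ∀ a, 0 ≤ m a)
    {w : Fin k ⊕ Fin l → ℝ} (hw : ∀ j, 0 ≤ w j) {r δ d : ℝ} (hr : r ≠ 0 ∨ ∃ j, w j ≠ 0)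
    (h : IsDelta μ m r w δ) (hd0 : 0 < d) (hd : d < δ) : r < cotSum μ m w d := by
  have hπ := hd.trans_le (h.le_pi_div hμ)
  rcases h with ⟨_, rfl⟩ | ⟨h0, _, hl⟩
  · linarith
  by_cases hw0 : ∀ j, w j = 0
  · rw [cotSum_of_forall_eq_zero hw0]
    refine lt_of_le_of_ne (le_of_not_gt fun h => h0 ⟨h, hw0⟩) ?_
    rcases hr with hr | ⟨j, hj⟩
    · exact hr
    · exact absurd (hw0 j) hj
  push Not at hw0
  by_contra hcon
  push Not at hcon
  obtain ⟨d1, h1, h2, h3⟩ := exists_lt_cotSum hμ hanti hm hw hw0 r hd0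
  have hc : ContinuousOn (cotSum μ m w) (Set.Icc d1 d) := fun τ hτ =>
    (continuousAt_cotSum fun j =>
      sn_ne_zero_of_mem_Icc hμ hanti hm j h1 hπ τ hτ).continuousWithinAt
  obtain ⟨τ, hτ, he⟩ := intermediate_value_Icc' h2.le hc ⟨hcon, h3.le⟩
  have := hl (Set.mem_insert_of_mem _ ⟨h1.trans_le hτ.1, he.symm⟩)
  linarith [hτ.2]

lemma IsDelta.cotSum_lt [NeZero k] (hμ : ∀ i, 0 < μ i) (hanti : Antitone μ) (hm : ∀ a, 0 ≤ m a)
    {w : Fin k ⊕ Fin l → ℝ} (hw : ∀ j, 0 ≤ w j) {r δ d : ℝ} (hr : r ≠ 0 ∨ ∃ j, w j ≠ 0)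
    (h : IsDelta μ m r w δ) (hd : δ < d) (hπ : d < Real.pi / μ 0) : cotSum μ m w d < r := by
  rcases h with ⟨⟨hr0, hw0⟩, rfl⟩ | ⟨_, hmem, _⟩
  · rwa [cotSum_of_forall_eq_zero hw0]
  rcases hmem with rfl | ⟨hδ, he⟩
  · exact absurd hπ (lt_asymm hd)
  by_cases hw0 : ∀ j, w j = 0
  · rw [cotSum_of_forall_eq_zero hw0] at he
    rcases hr with hr | ⟨j, hj⟩
    · exact absurd he hr
    · exact absurd (hw0 j) hj
  push Not at hw0
  rw [he]
  exact PlaneWave.cotSum_lt hμ hanti hm hw hw0 hδ hd hπ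

end Widths
end PlaneWave

namespace PlaneWave
-- Limits of pasts and futures from the scaling of a sequence.
section Limits

variable {k l : ℕ} {μ : Fin k → ℝ} {m : Fin l → ℝ}

/-- Up to the focal distance, slightly weakened focusing still beats `r`. -/
lemma IsDelta.exists_scaled_cotSum_lt [NeZero k] (hμ : ∀ i, 0 < μ i) (hanti : Antitone μ)
    (hm : ∀ a, 0 ≤ m a) {w : Fin k ⊕ Fin l → ℝ} (hw : ∀ j, 0 ≤ w j) {r δ d : ℝ}
    (hr : r ≠ 0 ∨ ∃ j, w j ≠ 0) (h : IsDelta μ m r w δ) (hd : δ < d) (hπ : d ≤ Real.pi / μ 0) :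
    ∃ t : ℝ, 0 < t ∧ t ≤ 1 ∧ d < Real.pi / (t * μ 0) ∧ cotSum (fun i => t * μ i) m w d < r := by
  have hδ := h.nonneg hμ
  rcases hπ.lt_or_eq with hπ | rfl
  · exact ⟨1, one_pos, le_rfl, by simpa using hπ, by simpa using h.cotSum_lt hμ hanti hm hw hr hd hπ⟩
  set D := Real.pi / μ 0 with hD
  -- Remaining case `d = π / μ 0`, where `sn` vanishes for the frequency `μ 0`. With frequencies `t
  -- μ`, the quotient at `D` is `t` times the original one at `t D`; for `t` near `1` one has `e < t
  -- D < D`, and monotonicity compares with the value at `e`.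
  obtain ⟨e, he, heD⟩ := exists_between hd
  have he0 : 0 < e := hδ.trans_lt he
  have hD0 : 0 < D := he0.trans heD
  have hF := h.cotSum_lt hμ hanti hm hw hr he heD
  rw [cotSum_eq] at hF
  let c : Fin k ⊕ Fin l → ℝ → ℝ := Sum.elim (fun _ t => t) (fun _ _ => 1)
  have hlim : Tendsto (fun t => ∑ j, w j * (c j t * (cs μ m j e / sn μ m j e))) (𝓝[<] 1)
      (𝓝 (∑ j, w j * (cs μ m j e / sn μ m j e))) := by
    refine tendsto_finsetSum _ fun j _ => Tendsto.const_mul (w j) ?_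
    have : Tendsto (c j) (𝓝[<] 1) (𝓝 1) := by
      rcases j with i | a
      · exact tendsto_id.mono_left nhdsWithin_le_nhds
      · exact tendsto_const_nhds
    simpa using this.mul_const (cs μ m j e / sn μ m j e)
  have hIoo : ∀ᶠ t in 𝓝[<] (1 : ℝ), t ∈ Set.Ioo (e / D) 1 :=
    Ioo_mem_nhdsLT ((div_lt_one hD0).2 heD)
  obtain ⟨t, ht, ht1, ht2⟩ := ((hlim.eventually (gt_mem_nhds hF)).and hIoo).exists
  have ht0 : 0 < t := (div_pos he0 hD0).trans ht1
  have hetD : e < t * D := (div_lt_iff₀ hD0).1 ht1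
  have htD : t * D < D := by nlinarith
  refine ⟨t, ht0, ht2.le, ?_, ?_⟩
  · rw [hD]
    exact div_lt_div_of_pos_left Real.pi_pos (mul_pos ht0 (hμ 0)) (by nlinarith [hμ 0])
  · refine lt_of_le_of_lt ?_ ht
    rw [cotSum_eq]
    refine Finset.sum_le_sum fun j _ => mul_le_mul_of_nonneg_left ?_ (hw j)
    rcases j with i | a
    · have h1 := cs_div_sn_lt hμ hm (Sum.inl i) hetD
        (sn_ne_zero_of_mem_Icc hμ hanti hm (Sum.inl i) he0 htD)
      have h2 : cs (fun i => t * μ i) m (Sum.inl i) D / sn (fun i => t * μ i) m (Sum.inl i) D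
          = t * (cs μ m (Sum.inl i) (t * D) / sn μ m (Sum.inl i) (t * D)) := by
        simp only [cs, sn, Sum.elim_inl]
        rw [show t * μ i * D = μ i * (t * D) by ring]
        ring
      rw [h2]
      exact mul_le_mul_of_nonneg_left h1.le ht0.le
    · have h1 := cs_div_sn_lt (μ := μ) hμ hm (Sum.inr a) heD (fun τ hτ => by
        have hτ0 := he0.trans_le hτ.1
        by_cases h : m a = 0
        · simpa [sn, h] using hτ0.ne'
        · simpa [sn, h] using hτ0.ne')
      simp only [c, Sum.elim_inr, one_mul]
      exact h1.le

lemma tendsto_div_of_sq_div {u N : ℕ → ℝ} {c : ℝ} (hN : Tendsto N atTop atTop)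
    (hc : Tendsto (fun n => u n ^ 2 / N n) atTop (𝓝 c)) :
    Tendsto (fun n => u n / N n) atTop (𝓝 0) := by
  have h1 : Tendsto (fun n => (u n / N n) ^ 2) atTop (𝓝 0) := by
    have := hc.mul hN.inv_tendsto_atTop
    rw [mul_zero] at this
    refine this.congr fun n => ?_
    simp only [Pi.inv_apply]
    ring
  have h2 := (Real.continuous_sqrt.tendsto 0).comp h1
  rw [Real.sqrt_zero] at h2
  refine tendsto_zero_iff_abs_tendsto_zero _ |>.2 (h2.congr fun n => ?_)
  simp [Real.sqrt_sq_eq_abs]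

/-- After division by `N` the action criteria depend only on `r` and `cotSum c`. The cross terms
vanish because `w² / N` converges and therefore `w / N → 0`. -/
lemma pastsConverge_of_scaling [NeZero k] (hμ : ∀ i, 0 < μ i) (hanti : Antitone μ)
    (hm : ∀ a, 0 ≤ m a) {s : ℕ → Point k l} {N : ℕ → ℝ} {c : Fin k ⊕ Fin l → ℝ} {r x δ : ℝ}
    (hN : Tendsto N atTop atTop) (hc0 : ∀ j, 0 ≤ c j)
    (hc : ∀ j, Tendsto (fun n => tr (s n) j ^ 2 / N n) atTop (𝓝 (c j)))
    (hr : Tendsto (fun n => 2 * xm (s n) / N n) atTop (𝓝 r))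
    (hx : Tendsto (fun n => xp (s n)) atTop (𝓝 x))
    (hrc : r ≠ 0 ∨ ∃ j, c j ≠ 0) (hδ : IsDelta μ m r c δ) :
    PastsConverge μ m s {p | (xp p : EReal) < ((x - δ : ℝ) : EReal)} := by
  have hδ0 := hδ.nonneg hμ
  have hδπ := hδ.le_pi_div hμ
  have hN0 : ∀ᶠ n in atTop, 0 < N n := hN.eventually_gt_atTop 0
  have hinv := hN.inv_tendsto_atTop
  refine pastsConverge_xp_lt (fun p hp => ?_) (fun p hp => ?_)
  · have hp' : δ < x - xp p := by
      have : xp p < x - δ := by exact_mod_cast hp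
      linarith
    have hgap : Tendsto (fun n => xp (s n) - xp p) atTop (𝓝 (x - xp p)) := hx.sub_const _
    rcases lt_or_ge (Real.pi / μ 0) (x - xp p) with hlt | hge
    · filter_upwards [hgap.eventually (lt_mem_nhds hlt)] with n hn
      exact chron_of_long hμ hn
    -- The limiting gap may equal `π / μ 0`, with the gaps of the sequence on either side; weakened
    -- frequencies keep `sn` positive there.
    obtain ⟨t, ht0, ht1, htπ, htr⟩ := hδ.exists_scaled_cotSum_lt hμ hanti hm hc0 hrc hp' hge
    set ν : Fin k → ℝ := fun i => t * μ i
    have hν0 : ∀ i, 0 < ν i := fun i => mul_pos ht0 (hμ i)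
    have hνa : Antitone ν := fun i j hij => mul_le_mul_of_nonneg_left (hanti hij) ht0.le
    have hνμ : ∀ i, ν i ^ 2 ≤ μ i ^ 2 := fun i =>
      pow_le_pow_left₀ (hν0 i).le (mul_le_of_le_one_left (hμ i).le ht1) 2
    have hd0 : 0 < x - xp p := hδ0.trans_lt hp'
    have hsn : ∀ j, 0 < sn ν m j (x - xp p) := fun j => sn_pos hν0 hνa hm j hd0 htπ
    have hsnn : ∀ j, Tendsto (fun n => sn ν m j (xp (s n) - xp p)) atTop
        (𝓝 (sn ν m j (x - xp p))) := fun j => ((continuous_sn j).tendsto _).comp hgap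
    have hcsn : ∀ j, Tendsto (fun n => cs ν m j (xp (s n) - xp p)) atTop
        (𝓝 (cs ν m j (x - xp p))) := fun j => ((continuous_cs j).tendsto _).comp hgap
    have hL : Tendsto (fun n => ∑ j, ((tr p j ^ 2 * (N n)⁻¹ + tr (s n) j ^ 2 / N n)
        * (cs ν m j (xp (s n) - xp p) / sn ν m j (xp (s n) - xp p))
        - 2 * (tr p j * (tr (s n) j / N n)) * (cs ν m j 0 / sn ν m j (xp (s n) - xp p)))) atTop
        (𝓝 (∑ j, ((tr p j ^ 2 * 0 + c j) * (cs ν m j (x - xp p) / sn ν m j (x - xp p))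
          - 2 * (tr p j * 0) * (cs ν m j 0 / sn ν m j (x - xp p))))) := by
      refine tendsto_finsetSum _ fun j _ => Tendsto.sub ?_ ?_
      · exact ((hinv.const_mul _).add (hc j)).mul ((hcsn j).div (hsnn j) (hsn j).ne')
      · exact (((tendsto_div_of_sq_div hN (hc j)).const_mul _).const_mul 2).mul
          (tendsto_const_nhds.div (hsnn j) (hsn j).ne')
    have hR : Tendsto (fun n => 2 * xm (s n) / N n - 2 * xm p * (N n)⁻¹) atTop
        (𝓝 (r - 2 * xm p * 0)) := hr.sub (hinv.const_mul _)
    have hlt := hL.eventually_lt hR (by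
      rw [cotSum_eq] at htr
      simpa using htr)
    filter_upwards [hlt, hN0, hgap.eventually (lt_mem_nhds hd0),
      eventually_all.2 fun j => (hsnn j).eventually (lt_mem_nhds (hsn j))] with n h1 h2 h3 h4
    refine chron_of_jacobi hνμ h3 rfl (fun j => (h4 j).ne') ?_
    have h5 := mul_lt_mul_of_pos_left h1 h2
    rw [Finset.mul_sum] at h5
    refine lt_of_eq_of_lt (Finset.sum_congr rfl fun j _ => ?_) (h5.trans_eq ?_)
    · have := (h4 j).ne'
      field_simp
    · field_simp
  · have hp' : x - xp p < δ := by
      have : x - δ < xp p := by exact_mod_cast hp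
      linarith
    have hq : Tendsto (fun y : ℕ × Point k l => y.2) (atTop ×ˢ 𝓝 p) (𝓝 p) := tendsto_snd
    have hn : Tendsto (fun y : ℕ × Point k l => y.1) (atTop ×ˢ 𝓝 p) atTop := tendsto_fst
    have hgap : Tendsto (fun y : ℕ × Point k l => xp (s y.1) - xp y.2) (atTop ×ˢ 𝓝 p)
        (𝓝 (x - xp p)) := (hx.comp hn).sub ((continuous_xp.tendsto p).comp hq)
    rcases lt_or_ge (x - xp p) 0 with hlt | hge
    · filter_upwards [hgap.eventually (gt_mem_nhds hlt)] with y hy hch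
      linarith [hch.xp_lt]
    -- The calibration is started at time `ε = d - gap > 0`, so that it ends near `d < δ`, where
    -- `cotSum` exceeds `r`. Its value at the starting point is negligible against `N`.
    obtain ⟨d, hd1, hd2⟩ := exists_between hp'
    have hd0 : 0 < d := hge.trans_lt hd1
    have hdπ : d < Real.pi / μ 0 := hd2.trans_le hδπ
    obtain ⟨ε, hε⟩ : ∃ ε, d - (x - xp p) = ε := ⟨_, rfl⟩
    have hε0 : 0 < ε := by linarith
    have hF := hδ.lt_cotSum hμ hanti hm hc0 hrc hd0 hd2
    have hgap' : Tendsto (fun y : ℕ × Point k l => xp (s y.1) - xp y.2 + ε) (atTop ×ˢ 𝓝 p)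
        (𝓝 d) := by
      have := hgap.add_const ε
      rwa [show x - xp p + ε = d by linarith] at this
    have hsn : ∀ j, 0 < sn μ m j d := fun j => sn_pos hμ hanti hm j hd0 hdπ
    have hinv' := hinv.comp hn
    have hL : Tendsto (fun y : ℕ × Point k l => ∑ j, tr (s y.1) j ^ 2 / N y.1
        * (cs μ m j (xp (s y.1) - xp y.2 + ε) / sn μ m j (xp (s y.1) - xp y.2 + ε))
        - (∑ j, tr y.2 j ^ 2 * (cs μ m j ε / sn μ m j ε)) * (N y.1)⁻¹) (atTop ×ˢ 𝓝 p)
        (𝓝 (∑ j, c j * (cs μ m j d / sn μ m j d)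
          - (∑ j, tr p j ^ 2 * (cs μ m j ε / sn μ m j ε)) * 0)) := by
      refine Tendsto.sub ?_ (Tendsto.mul ?_ hinv')
      · refine tendsto_finsetSum _ fun j _ => ((hc j).comp hn).mul ?_
        exact (((continuous_cs j).tendsto _).comp hgap').div
          (((continuous_sn j).tendsto _).comp hgap') (hsn j).ne'
      · refine tendsto_finsetSum _ fun j _ => Tendsto.mul_const _ ?_
        exact (((continuous_tr j).tendsto p).comp hq).pow 2
    have hR : Tendsto (fun y : ℕ × Point k l => 2 * xm (s y.1) / N y.1 - 2 * xm y.2 * (N y.1)⁻¹)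
        (atTop ×ˢ 𝓝 p) (𝓝 (r - 2 * xm p * 0)) :=
      (hr.comp hn).sub ((((continuous_xm.tendsto p).comp hq).const_mul 2).mul hinv')
    have hlt := hR.eventually_lt hL (by
      rw [cotSum_eq] at hF
      simpa using hF)
    filter_upwards [hlt, hn.eventually hN0, hgap'.eventually (gt_mem_nhds hdπ)]
      with y h1 h2 h3 hch
    have h4 := hch.action_le hμ hanti hm hε0 h3
    have h5 := mul_lt_mul_of_pos_left h1 h2
    rw [mul_sub, mul_sub, Finset.mul_sum] at h5
    have e1 : N y.1 * (2 * xm (s y.1) / N y.1) = 2 * xm (s y.1) := by field_simp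
    have e2 : ∀ z, N y.1 * (z * (N y.1)⁻¹) = z := fun z => by field_simp
    have e3 : ∀ j, N y.1 * (tr (s y.1) j ^ 2 / N y.1
        * (cs μ m j (xp (s y.1) - xp y.2 + ε) / sn μ m j (xp (s y.1) - xp y.2 + ε)))
        = tr (s y.1) j ^ 2
        * (cs μ m j (xp (s y.1) - xp y.2 + ε) / sn μ m j (xp (s y.1) - xp y.2 + ε)) := fun j => by
      field_simp
    simp only [e1, e2, e3] at h5
    linarith

lemma classM_of_frequently_bounded {s : ℕ → Point k l} {R : ℝ}
    (h : ∃ᶠ n in atTop, |xp (s n)| ≤ R ∧ |xm (s n)| ≤ R ∧ ∀ j, |tr (s n) j| ≤ R) : ClassM s := by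
  have hK : IsCompact (Metric.closedBall (0 : Point k l) R) := isCompact_closedBall _ _
  obtain ⟨p, _, hp⟩ := hK.exists_mapClusterPt_of_frequently (f := s) (h.mono fun n hn => by
    obtain ⟨h1, h2, h3⟩ := hn
    have hR : 0 ≤ R := (abs_nonneg _).trans h1
    rw [mem_closedBall_zero_iff]
    refine norm_prod_le_iff.2 ⟨h1, norm_prod_le_iff.2 ⟨h2, norm_prod_le_iff.2 ⟨?_, ?_⟩⟩⟩
    · exact (pi_norm_le_iff_of_nonneg hR).2 fun i => h3 (Sum.inl i)
    · exact (pi_norm_le_iff_of_nonneg hR).2 fun a => h3 (Sum.inr a))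
  exact ⟨p, hp⟩

/-- A sequence without limit point but with convergent `x⁺` has an unbounded scale. -/
lemma tendsto_scale_atTop {s : ℕ → Point k l} {N : ℕ → ℝ} {c : Fin k ⊕ Fin l → ℝ} {r x : ℝ}
    (hs : ¬ ClassM s) (hN : ∀ᶠ n in atTop, 0 < N n)
    (hc : ∀ j, Tendsto (fun n => tr (s n) j ^ 2 / N n) atTop (𝓝 (c j)))
    (hr : Tendsto (fun n => 2 * xm (s n) / N n) atTop (𝓝 r))
    (hx : Tendsto (fun n => xp (s n)) atTop (𝓝 x)) : Tendsto N atTop atTop := by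
  -- If `N` stayed bounded along a subsequence, so would all coordinates, and compactness would give
  -- a limit point.
  rw [tendsto_atTop]
  by_contra hcon
  push Not at hcon
  obtain ⟨B, hB⟩ := hcon
  have h1 : ∀ᶠ n in atTop, |xp (s n)| ≤ |x| + 1 :=
    hx.abs.eventually (ge_mem_nhds (lt_add_one _))
  have h2 : ∀ᶠ n in atTop, |2 * xm (s n) / N n| ≤ |r| + 1 :=
    hr.abs.eventually (ge_mem_nhds (lt_add_one _))
  have h3 : ∀ᶠ n in atTop, ∀ j, tr (s n) j ^ 2 / N n ≤ |c j| + 1 := eventually_all.2 fun j =>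
    (hc j).eventually (ge_mem_nhds ((le_abs_self _).trans_lt (lt_add_one _)))
  set C := ∑ j, (|c j| + 1) with hC
  have hcj : ∀ j, |c j| + 1 ≤ C := fun j =>
    Finset.single_le_sum (f := fun j => |c j| + 1) (fun i _ => by positivity) (Finset.mem_univ j)
  have hC0 : 0 ≤ C := Finset.sum_nonneg fun j _ => by positivity
  refine hs (classM_of_frequently_bounded (R := |x| + 1 + (|r| + 1) * |B| + (C * |B| + 1))
    ((hB.and_eventually (hN.and (h1.and (h2.and h3)))).mono ?_))
  rintro n ⟨hb, hn, h1, h2, h3⟩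
  have hb' : N n ≤ |B| := hb.le.trans (le_abs_self B)
  have p1 : 0 ≤ (|r| + 1) * |B| := by positivity
  have p2 : 0 ≤ C * |B| := by positivity
  have p3 := abs_nonneg x
  refine ⟨by linarith, ?_, fun j => ?_⟩
  · rw [abs_div, abs_of_pos hn, div_le_iff₀ hn, abs_mul, abs_two] at h2
    have := mul_le_mul_of_nonneg_left hb' (by positivity : 0 ≤ |r| + 1)
    linarith [abs_nonneg (xm (s n))]
  · have h4 := h3 j
    rw [div_le_iff₀ hn] at h4
    have h5 : (|c j| + 1) * N n ≤ C * |B| := mul_le_mul (hcj j) hb' hn.le hC0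
    have h6 : |tr (s n) j| ≤ tr (s n) j ^ 2 + 1 := by
      rw [← sq_abs]
      nlinarith [sq_nonneg (|tr (s n) j| - 1), abs_nonneg (tr (s n) j)]
    linarith

lemma tendsto_xp_reflect {s : ℕ → Point k l} {xt : EReal}
    (hx : Tendsto (fun n => (xp (s n) : EReal)) atTop (𝓝 xt)) :
    Tendsto (fun n => (xp ((reflect ∘ s) n) : EReal)) atTop (𝓝 (-xt)) :=
  ((continuous_neg.tendsto xt).comp hx).congr fun _ => (EReal.coe_neg _).symm

/-- Limits of the pasts and futures of a sequence from its scaling behaviour. -/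
lemma converge_of_scaling [NeZero k] (hμ : ∀ i, 0 < μ i) (hanti : Antitone μ)
    (hm : ∀ a, 0 ≤ m a) {s : ℕ → Point k l} {N : ℕ → ℝ} {c : Fin k ⊕ Fin l → ℝ} {r δm δp : ℝ}
    {xt : EReal} (hs : ¬ ClassM s) (hN : ∀ᶠ n in atTop, 0 < N n) (hc0 : ∀ j, 0 ≤ c j)
    (hc : ∀ j, Tendsto (fun n => tr (s n) j ^ 2 / N n) atTop (𝓝 (c j)))
    (hr : Tendsto (fun n => 2 * xm (s n) / N n) atTop (𝓝 r))
    (hx : Tendsto (fun n => (xp (s n) : EReal)) atTop (𝓝 xt))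
    (hrc : r ≠ 0 ∨ ∃ j, c j ≠ 0) (hδm : IsDelta μ m r c δm) (hδp : IsDelta μ m (-r) c δp) :
    PastsConverge μ m s {p | (xp p : EReal) < xt - (δm : EReal)} ∧
      FuturesConverge μ m s {p | xt + (δp : EReal) < (xp p : EReal)} := by
  have hxn := tendsto_xp_reflect hx
  induction xt with
  | bot =>
    refine ⟨by simpa using pastsConverge_of_tendsto_infinite hμ (Or.inr rfl) hx, ?_⟩
    refine futuresConverge_of_pasts ?_
    simpa using pastsConverge_of_tendsto_infinite hμ (Or.inl EReal.neg_bot) hxn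
  | top =>
    refine ⟨by simpa using pastsConverge_of_tendsto_infinite hμ (Or.inl rfl) hx, ?_⟩
    refine futuresConverge_of_pasts ?_
    simpa using pastsConverge_of_tendsto_infinite hμ (Or.inr EReal.neg_top) hxn
  | coe x =>
    have hx' : Tendsto (fun n => xp (s n)) atTop (𝓝 x) := EReal.tendsto_coe.1 hx
    have hNt := tendsto_scale_atTop hs hN hc hr hx'
    refine ⟨pastsConverge_of_scaling hμ hanti hm hNt hc0 hc hr hx' hrc hδm, ?_⟩
    refine futuresConverge_of_pasts ?_
    have := pastsConverge_of_scaling (s := reflect ∘ s) (x := -x) (r := -r) hμ hanti hm hNt hc0 hc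
      (hr.neg.congr fun n => by simp [neg_div]) hx'.neg (by simpa using hrc) hδp
    have e : ((-x - δp : ℝ) : EReal) = -((x : EReal) + (δp : EReal)) := by
      rw [← EReal.coe_add, ← EReal.coe_neg]
      congr 1
      ring
    rwa [e] at this

end Limits
end PlaneWave

namespace PlaneWave
-- Extended ratios, the classification and the individual classes.
section Classes

variable {k l : ℕ} {μ : Fin k → ℝ} {m : Fin l → ℝ}

lemma extRatio_of_ne {a b : ℝ} (hb : b ≠ 0) : extRatio a b = ((a / b : ℝ) : EReal) :=
  if_neg hb

lemma tendsto_extRatio_iff {a b : ℕ → ℝ} {c : ℝ} (hb : ∀ᶠ n in atTop, b n ≠ 0) :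
    Tendsto (fun n => extRatio (a n) (b n)) atTop (𝓝 (c : EReal)) ↔
      Tendsto (fun n => a n / b n) atTop (𝓝 c) := by
  rw [← EReal.tendsto_coe]
  exact tendsto_congr' (hb.mono fun n hn => extRatio_of_ne hn)

lemma eventually_eq_zero_of_tendsto_extRatio {a b : ℕ → ℝ} {c : ℝ}
    (h : Tendsto (fun n => extRatio (a n) (b n)) atTop (𝓝 (c : EReal))) :
    ∀ᶠ n in atTop, b n = 0 → a n = 0 := by
  filter_upwards [h.eventually (lt_mem_nhds (EReal.bot_lt_coe c)),
    h.eventually (gt_mem_nhds (EReal.coe_lt_top c))] with n h1 h2 hb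
  by_contra ha
  simp only [extRatio, hb, if_true, ha, if_false] at h1 h2
  split_ifs at h1 h2 <;> simp at h1 h2

lemma not_classM_comp {s : ℕ → Point k l} (hs : ¬ ClassM s) {φ : ℕ → ℕ}
    (hφ : Tendsto φ atTop atTop) : ¬ ClassM (s ∘ φ) := fun ⟨p, hp⟩ =>
  hs ⟨p, hp.of_comp hφ⟩

/-- A divergent ratio `w² / x⁻` makes `x⁻` negligible with respect to `w²`. -/
lemma tendsto_div_sq_of_extRatio {w x : ℕ → ℝ}
    (h : Tendsto (fun n => extRatio (w n ^ 2) (x n)) atTop (𝓝 ⊤) ∨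
      Tendsto (fun n => extRatio (w n ^ 2) (x n)) atTop (𝓝 ⊥)) :
    (∀ᶠ n in atTop, w n ≠ 0) ∧ Tendsto (fun n => x n / w n ^ 2) atTop (𝓝 0) := by
  have key : ∀ B : ℝ, 0 < B → ∀ᶠ n in atTop, w n ≠ 0 ∧ |x n / w n ^ 2| < B⁻¹ := by
    intro B hB
    have hev : ∀ᶠ n in atTop, (B : EReal) < extRatio (w n ^ 2) (x n) ∨
        extRatio (w n ^ 2) (x n) < ((-B : ℝ) : EReal) := by
      rcases h with h | h
      · exact (h.eventually (lt_mem_nhds (EReal.coe_lt_top B))).mono fun n hn => Or.inl hn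
      · exact (h.eventually (gt_mem_nhds (EReal.bot_lt_coe (-B)))).mono fun n hn => Or.inr hn
    filter_upwards [hev] with n hn
    by_cases hw : w n = 0
    · have h0 : extRatio (w n ^ 2) (x n) = ((0 : ℝ) : EReal) := by simp [extRatio, hw]
      rw [h0, EReal.coe_lt_coe_iff, EReal.coe_lt_coe_iff] at hn
      rcases hn with hn | hn <;> linarith
    refine ⟨hw, ?_⟩
    by_cases hx : x n = 0
    · simpa [hx] using hB
    have hBlt : B < |w n ^ 2 / x n| := by
      rw [extRatio_of_ne hx, EReal.coe_lt_coe_iff, EReal.coe_lt_coe_iff] at hn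
      exact lt_abs.2 (hn.imp_right fun h => by linarith)
    rw [← inv_div, abs_inv]
    exact inv_strictAnti₀ hB hBlt
  refine ⟨(key 1 one_pos).mono fun n hn => hn.1, ?_⟩
  rw [Metric.tendsto_nhds]
  intro ε hε
  filter_upwards [key ε⁻¹ (inv_pos.2 hε)] with n hn
  rw [Real.dist_eq, sub_zero]
  simpa only [inv_inv] using hn.2

lemma Dominant.eventually_ne {s : ℕ → Point k l} {z : Fin k ⊕ Fin l} {r : Fin k ⊕ Fin l → ℝ}
    (h : Dominant s z r) {j : Fin k ⊕ Fin l} (hj : ∀ᶠ n in atTop, tr (s n) j ≠ 0) :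
    ∀ᶠ n in atTop, tr (s n) z ≠ 0 := by
  filter_upwards [hj, eventually_eq_zero_of_tendsto_extRatio (h j)] with n h1 h2 h3
  exact h1 (h2 h3)

lemma exists_dominant [NeZero k] {s : ℕ → Point k l}
    (hr : ∀ i j, i ≠ j →
      ∃ L : EReal, Tendsto (fun n => extRatio (tr (s n) i) (tr (s n) j)) atTop (𝓝 L))
    {j : Fin k ⊕ Fin l} (hj : ∀ᶠ n in atTop, tr (s n) j ≠ 0) : ∃ z r, Dominant s z r := by
  have hmax : ∀ n, ∃ z, ∀ i, |tr (s n) i| ≤ |tr (s n) z| := fun n =>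
    Finite.exists_max fun i => |tr (s n) i|
  -- Pigeonhole: some coordinate is largest infinitely often. As the ratios to it converge, lying in
  -- `[-1, 1]` frequently already makes their limits finite.
  obtain ⟨z, hz⟩ : ∃ z, ∃ᶠ n in atTop, ∀ i, |tr (s n) i| ≤ |tr (s n) z| := by
    by_contra hcon
    push Not at hcon
    obtain ⟨n, hn⟩ := (eventually_all.2 hcon).exists
    obtain ⟨z, hz⟩ := hmax n
    obtain ⟨i, hi⟩ := hn z
    exact absurd (hz i) (not_le.2 hi)
  have hmem : ∃ᶠ n in atTop, tr (s n) z ≠ 0 ∧ ∀ i,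
      extRatio (tr (s n) i) (tr (s n) z) ∈ Set.Icc ((-1 : ℝ) : EReal) ((1 : ℝ) : EReal) := by
    refine (hz.and_eventually hj).mono ?_
    rintro n ⟨h1, h2⟩
    have h3 : 0 < |tr (s n) z| := (abs_pos.2 h2).trans_le (h1 j)
    refine ⟨abs_pos.1 h3, fun i => ?_⟩
    rw [extRatio_of_ne (abs_pos.1 h3)]
    have h4 : |tr (s n) i / tr (s n) z| ≤ 1 := by
      rw [abs_div]
      exact (div_le_one h3).2 (h1 i)
    exact ⟨EReal.coe_le_coe_iff.2 (abs_le.1 h4).1, EReal.coe_le_coe_iff.2 (abs_le.1 h4).2⟩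
  have hlim : ∀ i, i ≠ z → ∃ c : ℝ,
      Tendsto (fun n => extRatio (tr (s n) i) (tr (s n) z)) atTop (𝓝 (c : EReal)) := by
    intro i hi
    obtain ⟨L, hL⟩ := hr i z hi
    have hLm : L ∈ Set.Icc ((-1 : ℝ) : EReal) ((1 : ℝ) : EReal) :=
      isClosed_Icc.mem_of_frequently_of_tendsto (hmem.mono fun n hn => hn.2 i) hL
    have h1 : L ≠ ⊤ := (hLm.2.trans_lt (EReal.coe_lt_top _)).ne
    have h2 : L ≠ ⊥ := ((EReal.bot_lt_coe _).trans_le hLm.1).ne'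
    exact ⟨L.toReal, by rwa [EReal.coe_toReal h1 h2]⟩
  have hz0 : ∀ᶠ n in atTop, tr (s n) z ≠ 0 := by
    by_cases hjz : j = z
    · rwa [← hjz]
    · obtain ⟨c, hc⟩ := hlim j hjz
      filter_upwards [hj, eventually_eq_zero_of_tendsto_extRatio hc] with n h1 h2 h3
      exact h1 (h2 h3)
  have hall : ∀ i, ∃ c : ℝ,
      Tendsto (fun n => extRatio (tr (s n) i) (tr (s n) z)) atTop (𝓝 (c : EReal)) := by
    intro i
    by_cases hi : i = z
    · subst hi
      refine ⟨1, (tendsto_extRatio_iff hz0).2 (tendsto_const_nhds.congr' ?_)⟩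
      exact hz0.mono fun n hn => (div_self hn).symm
    · exact hlim i hi
  choose r hr using hall
  exact ⟨z, r, hr⟩

lemma Dominant.self_eq_one {s : ℕ → Point k l} {z : Fin k ⊕ Fin l} {r : Fin k ⊕ Fin l → ℝ}
    (h : Dominant s z r) (hz : ∀ᶠ n in atTop, tr (s n) z ≠ 0) : r z = 1 := by
  have h1 := (tendsto_extRatio_iff hz).1 (h z)
  exact tendsto_nhds_unique h1 (tendsto_const_nhds.congr' (hz.mono fun n hn => (div_self hn).symm))

lemma Dominant.change {s : ℕ → Point k l} {z z' : Fin k ⊕ Fin l} {r r' : Fin k ⊕ Fin l → ℝ}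
    (h : Dominant s z r) (h' : Dominant s z' r') (hz : ∀ᶠ n in atTop, tr (s n) z ≠ 0) (j) :
    r j = r' j * r z' := by
  have hz' := h'.eventually_ne hz
  have h1 := ((tendsto_extRatio_iff hz').1 (h' j)).mul ((tendsto_extRatio_iff hz).1 (h z'))
  refine tendsto_nhds_unique ((tendsto_extRatio_iff hz).1 (h j)) (h1.congr' ?_)
  filter_upwards [hz, hz'] with n h1 h2
  field_simp

/-- For `r = 0` the equation is homogeneous in the weights, so changing the dominant coordinate does
not move `δ`. -/
lemma isDelta_zero_mul_iff [NeZero k] {w w' : Fin k ⊕ Fin l → ℝ} {a : ℝ} (ha : a ≠ 0)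
    (hw : ∀ j, w j = w' j * a) (δ : ℝ) : IsDelta μ m 0 w δ ↔ IsDelta μ m 0 w' δ := by
  have h : ∀ d, cotSum μ m w d = cotSum μ m w' d * a := fun d => by
    rw [cotSum_eq, cotSum_eq, Finset.sum_mul]
    exact Finset.sum_congr rfl fun j _ => by rw [hw j]; ring
  have h' : ∀ d, (0 = cotSum μ m w d ↔ 0 = cotSum μ m w' d) := fun d => by
    rw [h d, eq_comm, mul_eq_zero, or_iff_left ha, eq_comm]
  simp only [IsDelta, h', lt_irrefl, false_and, not_false_eq_true, true_and, false_or]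

/-- Every sequence without limit point has a subsequence in one of the four classes. -/
lemma exists_subseq_class [NeZero k] {s : ℕ → Point k l} (hs : ¬ ClassM s) :
    ∃ φ : ℕ → ℕ, StrictMono φ ∧ (ClassOnePos (s ∘ φ) ∨ ClassOneNeg (s ∘ φ) ∨
      ClassExcept (s ∘ φ) ∨ AxisEscape (s ∘ φ)) := by
  obtain ⟨φ, hφ, hsign⟩ : ∃ φ : ℕ → ℕ, StrictMono φ ∧ ((∀ n, 0 < xm (s (φ n))) ∨
      (∀ n, xm (s (φ n)) < 0) ∨ ∀ n, xm (s (φ n)) = 0) := by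
    have hf : (∃ᶠ n in atTop, 0 < xm (s n)) ∨ (∃ᶠ n in atTop, xm (s n) < 0) ∨
        ∃ᶠ n in atTop, xm (s n) = 0 := by
      rw [← frequently_or_distrib, ← frequently_or_distrib]
      refine Frequently.of_forall fun n => ?_
      rcases lt_trichotomy (xm (s n)) 0 with h | h | h <;> simp [h]
    rcases hf with h | h | h <;> obtain ⟨φ, hφ, h⟩ := extraction_of_frequently_atTop h
    · exact ⟨φ, hφ, Or.inl h⟩
    · exact ⟨φ, hφ, Or.inr (Or.inl h)⟩
    · exact ⟨φ, hφ, Or.inr (Or.inr h)⟩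
  let F : Point k l → EReal × EReal × (Fin k ⊕ Fin l → EReal) ×
      (Fin k ⊕ Fin l → Fin k ⊕ Fin l → EReal) × (Fin k ⊕ Fin l → EReal) := fun p =>
    (xp p, xm p, fun j => tr p j, fun i j => extRatio (tr p i) (tr p j),
      fun j => extRatio (tr p j ^ 2) (xm p))
  obtain ⟨L, ψ, hψ, hL⟩ := CompactSpace.tendsto_subseq fun n => F (s (φ n))
  obtain ⟨L1, L2, L3, L4, L5⟩ := L
  have hL1 := (Prod.tendsto_iff _ _).1 hL
  have hL2 := (Prod.tendsto_iff _ _).1 hL1.2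
  have hL3 := (Prod.tendsto_iff _ _).1 hL2.2
  have hL4 := (Prod.tendsto_iff _ _).1 hL3.2
  have hxp : Tendsto (fun n => (xp (s (φ (ψ n))) : EReal)) atTop (𝓝 L1) := hL1.1
  have hxm : Tendsto (fun n => (xm (s (φ (ψ n))) : EReal)) atTop (𝓝 L2) := hL2.1
  have htr : ∀ j, Tendsto (fun n => (tr (s (φ (ψ n))) j : EReal)) atTop (𝓝 (L3 j)) :=
    tendsto_pi_nhds.1 hL3.1
  have hrat : ∀ i j, Tendsto (fun n => extRatio (tr (s (φ (ψ n))) i) (tr (s (φ (ψ n))) j)) atTop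
      (𝓝 (L4 i j)) := fun i => tendsto_pi_nhds.1 (tendsto_pi_nhds.1 hL4.1 i)
  have hsq : ∀ j, Tendsto (fun n => extRatio (tr (s (φ (ψ n))) j ^ 2) (xm (s (φ (ψ n))))) atTop
      (𝓝 (L5 j)) := tendsto_pi_nhds.1 hL4.2
  have hφψ := hφ.comp hψ
  have hsM := not_classM_comp hs hφψ.tendsto_atTop
  have hzero : ClassZero (s ∘ φ ∘ ψ) := ⟨⟨L1, hxp⟩, ⟨L2, hxm⟩, fun j => ⟨L3 j, htr j⟩⟩
  by_cases hinf : ∃ j, L5 j = ⊤ ∨ L5 j = ⊥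
  · obtain ⟨j, hj⟩ := hinf
    refine ⟨_, hφψ, Or.inr (Or.inr (Or.inl ⟨hzero, hsM, fun i j _ => ⟨_, hrat i j⟩, j, ?_⟩))⟩
    rcases hj with hj | hj
    · exact Or.inl (hj ▸ hsq j)
    · exact Or.inr (hj ▸ hsq j)
  push Not at hinf
  have hc : RatioLimits (s ∘ φ ∘ ψ) fun j => (L5 j).toReal := fun j => by
    rw [EReal.coe_toReal (hinf j).1 (hinf j).2]
    exact hsq j
  rcases hsign with h | h | h
  · exact ⟨_, hφψ, Or.inl ⟨⟨hzero, hsM, _, hc⟩, fun n => h _⟩⟩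
  · exact ⟨_, hφψ, Or.inr (Or.inl ⟨⟨hzero, hsM, _, hc⟩, fun n => h _⟩)⟩
  -- With `x⁻ = 0` a nonzero coordinate has ratio `+∞`, so finite limits force all of them to vanish
  -- eventually. Then only `x⁺` can escape.
  have htr0 : ∀ᶠ n in atTop, ∀ j, tr (s (φ (ψ n))) j = 0 := by
    refine eventually_all.2 fun j => ?_
    filter_upwards [eventually_eq_zero_of_tendsto_extRatio (hc j)] with n hn
    exact pow_eq_zero_iff two_ne_zero |>.1 (hn (h (ψ n)))
  obtain ⟨n0, hn0⟩ := eventually_atTop.1 htr0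
  have hadd : StrictMono fun n : ℕ => n + n0 := fun a b hab => Nat.add_lt_add_right hab n0
  refine ⟨_, hφψ.comp hadd, Or.inr (Or.inr (Or.inr ⟨fun n => ⟨h _, hn0 _ (Nat.le_add_left _ _)⟩,
    ?_⟩))⟩
  have hxp' := hxp.comp hadd.tendsto_atTop
  rcases eq_or_ne L1 ⊤ with rfl | h1
  · exact Or.inl (EReal.tendsto_coe_nhds_top_iff.1 hxp')
  rcases eq_or_ne L1 ⊥ with rfl | h2
  · exact Or.inr (EReal.tendsto_coe_nhds_bot_iff.1 hxp')
  rw [← EReal.coe_toReal h1 h2] at hxp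
  have hx := (EReal.tendsto_coe.1 hxp).abs.eventually (ge_mem_nhds (lt_add_one _))
  refine absurd (classM_of_frequently_bounded (R := |L1.toReal| + 1)
    ((hx.and htr0).frequently.mono ?_)) hsM
  rintro n ⟨hn, hn'⟩
  have hR : 0 ≤ |L1.toReal| + 1 := by positivity
  exact ⟨hn, by simpa [h] using hR, fun j => by simpa [hn' j] using hR⟩

lemma ClassOnePos.converge [NeZero k] (hμ : ∀ i, 0 < μ i) (hanti : Antitone μ)
    (hm : ∀ a, 0 ≤ m a) {s : ℕ → Point k l} (h : ClassOnePos s) :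
    ∃ (xt : EReal) (c : Fin k ⊕ Fin l → ℝ) (δm δp : ℝ),
      Tendsto (fun n => (xp (s n) : EReal)) atTop (𝓝 xt) ∧ RatioLimits s c ∧
      IsDelta μ m 2 c δm ∧ IsDelta μ m (-2) c δp ∧
      PastsConverge μ m s {p | (xp p : EReal) < xt - (δm : EReal)} ∧
      FuturesConverge μ m s {p | xt + (δp : EReal) < (xp p : EReal)} := by
  obtain ⟨⟨⟨⟨xt, hx⟩, _⟩, hs, c, hc⟩, hpos⟩ := h
  have hc' : ∀ j, Tendsto (fun n => tr (s n) j ^ 2 / xm (s n)) atTop (𝓝 (c j)) := fun j =>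
    (tendsto_extRatio_iff (Eventually.of_forall fun n => (hpos n).ne')).1 (hc j)
  have hc0 : ∀ j, 0 ≤ c j := fun j =>
    ge_of_tendsto' (hc' j) fun n => div_nonneg (sq_nonneg _) (hpos n).le
  obtain ⟨δm, hδm⟩ := exists_isDelta hμ hanti hm hc0 (r := 2) (Or.inl two_ne_zero)
  obtain ⟨δp, hδp⟩ := exists_isDelta hμ hanti hm hc0 (r := -2)
    (Or.inl (neg_ne_zero.2 two_ne_zero))
  refine ⟨xt, c, δm, δp, hx, hc, hδm, hδp, ?_⟩
  refine converge_of_scaling hμ hanti hm hs (Eventually.of_forall hpos) hc0 hc' ?_ hx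
    (Or.inl two_ne_zero) hδm hδp
  exact tendsto_const_nhds.congr fun n => (mul_div_cancel_right₀ 2 (hpos n).ne').symm

lemma ClassOneNeg.converge [NeZero k] (hμ : ∀ i, 0 < μ i) (hanti : Antitone μ)
    (hm : ∀ a, 0 ≤ m a) {s : ℕ → Point k l} (h : ClassOneNeg s) :
    ∃ (xt : EReal) (c : Fin k ⊕ Fin l → ℝ) (δm δp : ℝ),
      Tendsto (fun n => (xp (s n) : EReal)) atTop (𝓝 xt) ∧ RatioLimits s c ∧
      IsDelta μ m (-2) (fun j => |c j|) δm ∧ IsDelta μ m 2 (fun j => |c j|) δp ∧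
      PastsConverge μ m s {p | (xp p : EReal) < xt - (δm : EReal)} ∧
      FuturesConverge μ m s {p | xt + (δp : EReal) < (xp p : EReal)} := by
  obtain ⟨⟨⟨⟨xt, hx⟩, _⟩, hs, c, hc⟩, hneg⟩ := h
  have hc' : ∀ j, Tendsto (fun n => tr (s n) j ^ 2 / -xm (s n)) atTop (𝓝 |c j|) := fun j => by
    have h1 := ((tendsto_extRatio_iff (Eventually.of_forall fun n => (hneg n).ne)).1 (hc j)).abs
    refine h1.congr fun n => ?_
    rw [abs_div, abs_of_neg (hneg n), abs_of_nonneg (sq_nonneg _)]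
  have hc0 : ∀ j, 0 ≤ |c j| := fun j => abs_nonneg _
  obtain ⟨δm, hδm⟩ := exists_isDelta hμ hanti hm hc0 (r := -2)
    (Or.inl (neg_ne_zero.2 two_ne_zero))
  obtain ⟨δp, hδp⟩ := exists_isDelta hμ hanti hm hc0 (r := 2) (Or.inl two_ne_zero)
  refine ⟨xt, c, δm, δp, hx, hc, hδm, hδp, ?_⟩
  refine converge_of_scaling hμ hanti hm hs (N := fun n => -xm (s n))
    (Eventually.of_forall fun n => neg_pos.2 (hneg n)) hc0 hc' ?_ hx
    (Or.inl (neg_ne_zero.2 two_ne_zero)) hδm (by rwa [neg_neg])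
  refine tendsto_const_nhds.congr fun n => ?_
  rw [div_neg, mul_div_cancel_right₀ 2 (hneg n).ne]

lemma ClassExcept.converge [NeZero k] (hμ : ∀ i, 0 < μ i) (hanti : Antitone μ)
    (hm : ∀ a, 0 ≤ m a) {s : ℕ → Point k l} (h : ClassExcept s) :
    ∃ (xt : EReal) (δ : ℝ),
      Tendsto (fun n => (xp (s n) : EReal)) atTop (𝓝 xt) ∧
      (∃ z r, Dominant s z r) ∧
      (∀ z r, Dominant s z r → IsDelta μ m 0 (fun j => r j ^ 2) δ) ∧
      PastsConverge μ m s {p | (xp p : EReal) < xt - (δ : EReal)} ∧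
      FuturesConverge μ m s {p | xt + (δ : EReal) < (xp p : EReal)} := by
  obtain ⟨⟨⟨xt, hx⟩, _⟩, hs, hrat, j, hj⟩ := h
  obtain ⟨hj0, hjx⟩ := tendsto_div_sq_of_extRatio hj
  obtain ⟨z, r, hz⟩ := exists_dominant hrat hj0
  have hz0 := hz.eventually_ne hj0
  have hc0 : ∀ j, 0 ≤ r j ^ 2 := fun j => sq_nonneg _
  have hrc : ∃ j, r j ^ 2 ≠ 0 := ⟨z, by simp [hz.self_eq_one hz0]⟩
  have hlim : ∀ j, Tendsto (fun n => tr (s n) j / tr (s n) z) atTop (𝓝 (r j)) := fun j =>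
    (tendsto_extRatio_iff hz0).1 (hz j)
  obtain ⟨δ, hδ⟩ := exists_isDelta hμ hanti hm hc0 (Or.inr hrc) (r := 0)
  refine ⟨xt, δ, hx, ⟨z, r, hz⟩, fun z' r' hz' => ?_, ?_⟩
  · refine (isDelta_zero_mul_iff (a := r z' ^ 2) ?_ (fun i => ?_) δ).1 hδ
    · refine pow_ne_zero 2 fun h0 => ?_
      have := hz.change hz' hz0 z
      rw [hz.self_eq_one hz0, h0, mul_zero] at this
      exact one_ne_zero this
    · rw [hz.change hz' hz0 i, mul_pow]
  -- Some `w²` dominates `x⁻`, and `z²` dominates `w²` up to a constant; hence `r = 0` and both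
  -- widths coincide.
  · refine converge_of_scaling hμ hanti hm hs (N := fun n => tr (s n) z ^ 2) (r := 0)
      (hz0.mono fun n hn => by positivity) hc0 (fun j => ?_) ?_ hx (Or.inr hrc) hδ (by simpa using hδ)
    · exact ((hlim j).pow 2).congr fun n => div_pow _ _ _
    · have h1 := (hjx.mul ((hlim j).pow 2)).const_mul 2
      rw [zero_mul, mul_zero] at h1
      refine h1.congr' ?_
      filter_upwards [hj0, hz0] with n h2 h3
      field_simp

end Classes
end PlaneWave

theorem mainTheorem2 {k l : ℕ} [NeZero k] (μ : Fin k → ℝ) (m : Fin l → ℝ)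
    (hμ : ∀ i, 0 < μ i) (hanti : Antitone μ) (hm : ∀ a, 0 ≤ m a) :
    -- every sequence without limit point has a subsequence in one of the classes
    (∀ s : ℕ → Point k l, ¬ ClassM s → ∃ φ : ℕ → ℕ, StrictMono φ ∧
      (ClassOnePos (s ∘ φ) ∨ ClassOneNeg (s ∘ φ) ∨ ClassExcept (s ∘ φ) ∨ AxisEscape (s ∘ φ))) ∧
    -- limits of the sequences with `x⁻ > 0` in the generic class
    (∀ s : ℕ → Point k l, ClassOnePos s →
      ∃ (xt : EReal) (c : Fin k ⊕ Fin l → ℝ) (δm δp : ℝ),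
        Tendsto (fun n => (xp (s n) : EReal)) atTop (𝓝 xt) ∧ RatioLimits s c ∧
        IsDelta μ m 2 c δm ∧ IsDelta μ m (-2) c δp ∧
        PastsConverge μ m s {p | (xp p : EReal) < xt - (δm : EReal)} ∧
        FuturesConverge μ m s {p | xt + (δp : EReal) < (xp p : EReal)}) ∧
    -- limits of the sequences with `x⁻ < 0` in the generic class
    (∀ s : ℕ → Point k l, ClassOneNeg s →
      ∃ (xt : EReal) (c : Fin k ⊕ Fin l → ℝ) (δm δp : ℝ),
        Tendsto (fun n => (xp (s n) : EReal)) atTop (𝓝 xt) ∧ RatioLimits s c ∧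
        IsDelta μ m (-2) (fun j => |c j|) δm ∧ IsDelta μ m 2 (fun j => |c j|) δp ∧
        PastsConverge μ m s {p | (xp p : EReal) < xt - (δm : EReal)} ∧
        FuturesConverge μ m s {p | xt + (δp : EReal) < (xp p : EReal)}) ∧
    -- limits of the exceptional sequences; here both widths agree
    (∀ s : ℕ → Point k l, ClassExcept s →
      ∃ (xt : EReal) (δ : ℝ),
        Tendsto (fun n => (xp (s n) : EReal)) atTop (𝓝 xt) ∧
        (∃ z r, Dominant s z r) ∧
        (∀ z r, Dominant s z r → IsDelta μ m 0 (fun j => r j ^ 2) δ) ∧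
        PastsConverge μ m s {p | (xp p : EReal) < xt - (δ : EReal)} ∧
        FuturesConverge μ m s {p | xt + (δ : EReal) < (xp p : EReal)}) ∧
    -- limits of all sequences with `x⁺ → ±∞`, in particular of the degenerate ones on the axis
    (∀ s : ℕ → Point k l, ∀ xt : EReal, (xt = ⊤ ∨ xt = ⊥) →
      Tendsto (fun n => (xp (s n) : EReal)) atTop (𝓝 xt) →
        PastsConverge μ m s {p | (xp p : EReal) < xt} ∧
        FuturesConverge μ m s {p | xt < (xp p : EReal)}) := by
  refine ⟨fun s hs => exists_subseq_class hs, fun s hs => hs.converge hμ hanti hm,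
    fun s hs => hs.converge hμ hanti hm, fun s hs => hs.converge hμ hanti hm,
    fun s xt hxt hx => ⟨pastsConverge_of_tendsto_infinite hμ hxt hx,
      futuresConverge_of_pasts (pastsConverge_of_tendsto_infinite hμ ?_ ?_)⟩⟩
  · rcases hxt with rfl | rfl <;> simp
  · exact tendsto_xp_reflect hx
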